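/- \textbf{Setting.} Let $k\ge 1$, let $\Sigma$ be a known positive definite $k\times k$ matrix, and write $\|v\|_\Sigma^2=v^T\Sigma^{-1}v$. Let $0<a<1$ and let $\ell:(0,\infty)\to[0,\infty)$ be slowly varying, nondecreasing and bounded, with $\ell(u)\ge m>0$ for all $u\ge u_0$, for some $u_0,m>0$, and such that $\pi(u)=K u^{-a-1}\ell(u)$ is a probability density on $(0,\infty)$ for some constant $K>0$. For $\tau\in(0,1)$ consider the model $X\mid\theta\sim N_k(\theta,\Sigma)$, $\theta\mid\lambda^2\sim N_k(0,\lambda^2\tau\Sigma)$, $\lambda^2\sim\pi$. Let $\Pi(\cdot\mid X)$ be the posterior law of $\theta$, $\hat\theta=E(\theta\mid X)$ the posterior mean, and, for $\alpha\in(0,1)$, let $\hat r=\hat r(\alpha,\tau)$ be determined by $\Pi(\|\theta-\hat\theta\|_\Sigma^2\le\hat r\mid X)=1-\alpha$. For $\rho>0$ and $L>0$ let $$\hat C=\{\theta\in\mathbb R^k:\ \|\theta-\hat\theta\|_\Sigma^2\le L\,\hat r^{\,a/(1+\rho)}\}.$$ Write $\chi^2_{k,p}$ for the upper $p$-quantile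 of the chi-square distribution with $k$ degrees of freedom, and $P_{\theta_0}$ for probability under $X\sim N_k(\theta_0,\Sigma)$. \textbf{Theorem.} There is a function $f:\tau\mapsto f_\tau$ with $f_\tau\to\infty$ and $f_\tau\tau\to 0$ as $\tau\downarrow 0$, which does not depend on the quantities introduced above or below, such that the following holds in the setting above. Let $K_S>0$, $0<K_M<2a<K_L$, $0<\alpha<\beta<1$, $\rho>0$ and $L>\chi^2_{k,\alpha}\,(\chi^2_{k,\beta})^{-a/(1+\rho)}$, and let $\tau_n\in(0,1)$ with $\tau_n\to 0$. Then, with $\hat C_n$ the set $\hat C$ for $\tau=\tau_n$: \begin{enumerate} \item for all sufficiently large $n$, $P_{\theta_0}(\theta_0\in\hat C_n)\ge 1-\alpha$ for every $\theta_0$ with $\|\theta_0\|_\Sigma^2\le K_S\tau_n$; \item $P_{\theta_0}(\theta_0\notin\hat C_n)\to 1$ as $n\to\infty$, uniformly over all $\theta_0$ with $f_{\tau_n}\tau_n\le\|\theta_0\|_\Sigma^2\le K_M\log(1/\tau_n)$; \item for all sufficiently large $n$, $P_{\theta_0}(\theta_0\in\hat C_n)\ge 1-\alpha$ for every $\theta_0$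 with $\|\theta_0\|_\Sigma^2\ge K_L\log(1/\tau_n)$. \end{enumerate} -/

import Mathlib

open MeasureTheory ProbabilityTheory Filter Topology Matrix

noncomputable section

namespace GlobalLocal

/-- `ℝᵏ` with its Euclidean structure. -/
abbrev Vec (k : ℕ) := EuclideanSpace ℝ (Fin k)

variable {k : ℕ}

/-- Squared Mahalanobis norm `‖v‖²_S = vᵀ S⁻¹ v`. -/
def mahalSq (S : Matrix (Fin k) (Fin k) ℝ) (v : Vec k) : ℝ :=
  v.ofLp ⬝ᵥ (S⁻¹ *ᵥ v.ofLp)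

/-- The measure on `(0, ∞)` with Lebesgue density `K u^(-a-1) ℓ(u)`: the law of the local scale
`λ²`. -/
def localLaw (a K : ℝ) (ℓ : ℝ → ℝ) : Measure ℝ :=
  (volume.restrict (Set.Ioi 0)).withDensity
    (fun u => ENNReal.ofReal (K * u ^ (-a - 1) * ℓ u))

/-- `ℓ` is slowly varying at infinity. -/
def SlowlyVarying (ℓ : ℝ → ℝ) : Prop :=
  ∀ c : ℝ, 0 < c → Tendsto (fun u => ℓ (c * u) / ℓ u) atTop (𝓝 1)

/-- `u ↦ K u^(-a-1) ℓ(u)` is a probability density on `(0, ∞)`, where `a > 0` and the slowly varying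
function `ℓ ≥ 0` is nondecreasing, bounded, and bounded away from zero on some half-line `[u₀, ∞)`.
(With a lower bound `m > 0` down to `0` the density would not be integrable near `0`.) -/
structure IsLocalPrior (a K : ℝ) (ℓ : ℝ → ℝ) : Prop where
  a_pos : 0 < a
  K_pos : 0 < K
  nonneg : ∀ u, 0 < u → 0 ≤ ℓ u
  slowlyVarying : SlowlyVarying ℓ
  mono : MonotoneOn ℓ (Set.Ioi 0)
  bddAbove : ∃ M : ℝ, ∀ u, 0 < u → ℓ u ≤ M
  bddBelow : ∃ u₀ m : ℝ, 0 < u₀ ∧ 0 < m ∧ ∀ u, u₀ ≤ u → m ≤ ℓ u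
  proper : localLaw a K ℓ Set.univ = 1

/-- The prior law of `θ`: `λ²` is drawn from `localLaw`, and `θ | λ² ∼ N(0, λ² τ S)`. -/
def priorLaw (S : Matrix (Fin k) (Fin k) ℝ) (a K : ℝ) (ℓ : ℝ → ℝ) (τ : ℝ) : Measure (Vec k) :=
  (localLaw a K ℓ).bind (fun u => multivariateGaussian 0 ((u * τ) • S))

/-- The density of `N(θ, S)` at `x`. -/
def normalDensity (S : Matrix (Fin k) (Fin k) ℝ) (θ x : Vec k) : ℝ :=
  (√((2 * Real.pi) ^ k * S.det))⁻¹ * Real.exp (-(mahalSq S (x - θ)) / 2)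

/-- The posterior law of `θ` given `X = x`, where `X | θ ∼ N(θ, S)`, by Bayes' formula. -/
def posteriorLaw (S : Matrix (Fin k) (Fin k) ℝ) (a K : ℝ) (ℓ : ℝ → ℝ) (τ : ℝ) (x : Vec k) :
    Measure (Vec k) :=
  (∫⁻ θ, ENNReal.ofReal (normalDensity S θ x) ∂(priorLaw S a K ℓ τ))⁻¹ •
    (priorLaw S a K ℓ τ).withDensity (fun θ => ENNReal.ofReal (normalDensity S θ x))

/-- The Bayes estimator: the posterior mean `E(θ | X = x)`. -/
def posteriorMean (S : Matrix (Fin k) (Fin k) ℝ) (a K : ℝ) (ℓ : ℝ → ℝ) (τ : ℝ) (x : Vec k) :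
    Vec k :=
  ∫ θ, θ ∂(posteriorLaw S a K ℓ τ x)

/-- The posterior `(1-α)`-quantile of `‖θ - θ̂‖²_S`. As the posterior law of this quantity has a
continuous distribution function, strictly increasing on `[0, ∞)`, this is the unique `r` with
`Π(‖θ - θ̂‖²_S ≤ r | X = x) = 1 - α`. -/
def credRadius (S : Matrix (Fin k) (Fin k) ℝ) (a K : ℝ) (ℓ : ℝ → ℝ) (α τ : ℝ) (x : Vec k) : ℝ :=
  sInf {r : ℝ | 0 ≤ r ∧ 1 - α ≤ (posteriorLaw S a K ℓ τ x).real
    {θ | mahalSq S (θ - posteriorMean S a K ℓ τ x) ≤ r}}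

/-- The credible ball `{θ : ‖θ - θ̂‖²_S ≤ L r̂^(a/(1+ρ))}`. -/
def credSet (S : Matrix (Fin k) (Fin k) ℝ) (a K : ℝ) (ℓ : ℝ → ℝ) (α ρ L τ : ℝ) (x : Vec k) :
    Set (Vec k) :=
  {θ | mahalSq S (θ - posteriorMean S a K ℓ τ x) ≤
    L * credRadius S a K ℓ α τ x ^ (a / (1 + ρ))}

/-- The probability under `X ∼ N(θ₀, S)` that the credible ball contains `θ₀`. -/
def coverProb (S : Matrix (Fin k) (Fin k) ℝ) (a K : ℝ) (ℓ : ℝ → ℝ) (α ρ L τ : ℝ)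
    (θ₀ : Vec k) : ℝ :=
  (multivariateGaussian θ₀ S).real {x | θ₀ ∈ credSet S a K ℓ α ρ L τ x}

/-- The probability under `X ∼ N(θ₀, S)` that the credible ball misses `θ₀`. -/
def missProb (S : Matrix (Fin k) (Fin k) ℝ) (a K : ℝ) (ℓ : ℝ → ℝ) (α ρ L τ : ℝ)
    (θ₀ : Vec k) : ℝ :=
  (multivariateGaussian θ₀ S).real {x | θ₀ ∉ credSet S a K ℓ α ρ L τ x}

/-- The chi-square distribution with `k` degrees of freedom: the law of the sum of squares of `k`
independent standard normal variables. -/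
def chiSqLaw (k : ℕ) : Measure ℝ :=
  (Measure.pi (fun _ : Fin k => gaussianReal 0 1)).map (fun z => ∑ i, z i ^ 2)

/-- The upper `p`-quantile `χ²_{k,p}`, i.e. `P(χ²_k > χ²_{k,p}) = p`. -/
def chiSqUpper (k : ℕ) (p : ℝ) : ℝ :=
  sInf {t : ℝ | 0 ≤ t ∧ 1 - p ≤ (chiSqLaw k).real (Set.Iic t)}

/-- Small means: `‖θ‖²_S ≤ K_S τ`. -/
def smallMeans (S : Matrix (Fin k) (Fin k) ℝ) (KS τ : ℝ) : Set (Vec k) :=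
  {θ | mahalSq S θ ≤ KS * τ}

/-- Intermediate means: `f_τ τ ≤ ‖θ‖²_S ≤ K_M log (1/τ)`. -/
def mediumMeans (S : Matrix (Fin k) (Fin k) ℝ) (f : ℝ → ℝ) (KM τ : ℝ) : Set (Vec k) :=
  {θ | f τ * τ ≤ mahalSq S θ ∧ mahalSq S θ ≤ KM * Real.log (1 / τ)}

/-- Large means: `‖θ‖²_S ≥ K_L log (1/τ)`. -/
def largeMeans (S : Matrix (Fin k) (Fin k) ℝ) (KL τ : ℝ) : Set (Vec k) :=
  {θ | KL * Real.log (1 / τ) ≤ mahalSq S θ}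

end GlobalLocal

end

/-! ### Whitening by the symmetric square root; the density of the standard Gaussian law. -/

noncomputable section

namespace GlobalLocal

open scoped MatrixOrder
variable {k : ℕ}

/-! Put y = S^(-1/2) x, t = ‖y‖², κ = uτ and s = κ/(1+κ). Completing the square
(`lintegral_gaussian_conjugate`) shows that, in whitened coordinates, the posterior is a mixture of
the laws N(s y, s I), where u is drawn from the prior reweighted by (1+κ)^(-k/2) exp(-t/(2(1+κ)))
(`posteriorLaw_eq_map`). Hence the posterior mean is m y with m the mean of s, and everything
reduces to where the one-dimensional law of s sits, given t and τ.

Two general facts convert this into bounds on the credible radius. Markov's inequality bounds it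
above in terms of m (`credRadius_le`). Since a centred ball has the largest Gaussian mass, it is
bounded below as soon as s is rarely small (`le_credRadius`).

The evidence is at least a constant times exp(-t/2). For bounded t this keeps s from falling far
below τ (`exists_postScale_small_le`), and for every b < a it gives m ≤ C τ^b exp(t/2)
(`exists_shrinkMean_le`). For small means the radius is therefore at least of order τ, while the
squared error is o(τ^(a/(1+ρ))). For medium means t stays below K' log(1/τ) with K' < 2a, so m and
the radius are powers of τ, and the ball around nearly zero misses any mean with squared norm at
least 1/log(1/τ).

For large t the scales u near t/τ contribute evidence of order τ^a up to powers of t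
(`le_evidence_of_large`). Once t ≥ K' log(1/τ) with K' > 2a this beats the shrinking scales, so s
concentrates at one (`exists_no_shrinkage`): the posterior mean is X + o(1) and the radius is nearly
the chi-square quantile at β or larger. The condition on L then gives coverage.

In each regime the argument is deterministic on an event ‖z‖² ≤ R for the whitened noise z, which
makes it uniform in the mean. -/

lemma sqrt_mul_sqrt_of_posDef {S : Matrix (Fin k) (Fin k) ℝ} (hS : S.PosDef) :
    CFC.sqrt S * CFC.sqrt S = S :=
  CFC.sqrt_mul_sqrt_self S hS.posSemidef.nonneg

lemma isUnit_det_sqrt {S : Matrix (Fin k) (Fin k) ℝ} (hS : S.PosDef) :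
    IsUnit (CFC.sqrt S).det := by
  have h := congrArg Matrix.det (sqrt_mul_sqrt_of_posDef hS)
  rw [Matrix.det_mul] at h
  refine isUnit_iff_ne_zero.2 fun h0 => ?_
  rw [h0, zero_mul] at h
  exact hS.det_pos.ne h

lemma sqrt_transpose {S : Matrix (Fin k) (Fin k) ℝ} : (CFC.sqrt S)ᵀ = CFC.sqrt S := by
  have : (CFC.sqrt S).PosSemidef := Matrix.nonneg_iff_posSemidef.1 (CFC.sqrt_nonneg S)
  simpa using this.isHermitian.eq

lemma sqrt_smul {S : Matrix (Fin k) (Fin k) ℝ} (hS : S.PosDef) {c : ℝ} (hc : 0 ≤ c) :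
    CFC.sqrt (c • S) = √c • CFC.sqrt S := by
  refine CFC.sqrt_unique ?_ ?_
  · rw [smul_mul_smul_comm, Real.mul_self_sqrt hc, sqrt_mul_sqrt_of_posDef hS]
  · exact smul_nonneg (Real.sqrt_nonneg c) (CFC.sqrt_nonneg S)

/-- The symmetric square root of `S`, as a continuous linear map. -/
def sqrtCLM (S : Matrix (Fin k) (Fin k) ℝ) : Vec k →L[ℝ] Vec k :=
  toEuclideanCLM (𝕜 := ℝ) (CFC.sqrt S)

/-- The inverse of the symmetric square root of `S`: the whitening map. -/
def whiten (S : Matrix (Fin k) (Fin k) ℝ) : Vec k →L[ℝ] Vec k :=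
  toEuclideanCLM (𝕜 := ℝ) (CFC.sqrt S)⁻¹

lemma whiten_sqrtCLM {S : Matrix (Fin k) (Fin k) ℝ} (hS : S.PosDef) (z : Vec k) :
    whiten S (sqrtCLM S z) = z := by
  rw [whiten, sqrtCLM, ← ContinuousLinearMap.comp_apply, ← ContinuousLinearMap.mul_def, ← map_mul,
    Matrix.nonsing_inv_mul _ (isUnit_det_sqrt hS), map_one]
  rfl

lemma sqrtCLM_whiten {S : Matrix (Fin k) (Fin k) ℝ} (hS : S.PosDef) (z : Vec k) :
    sqrtCLM S (whiten S z) = z := by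
  rw [whiten, sqrtCLM, ← ContinuousLinearMap.comp_apply, ← ContinuousLinearMap.mul_def, ← map_mul,
    Matrix.mul_nonsing_inv _ (isUnit_det_sqrt hS), map_one]
  rfl

lemma mahalSq_eq {S : Matrix (Fin k) (Fin k) ℝ} (hS : S.PosDef) (v : Vec k) :
    mahalSq S v = ‖whiten S v‖ ^ 2 := by
  rw [mahalSq, ← sqrt_mul_sqrt_of_posDef hS, Matrix.mul_inv_rev, sqrt_mul_sqrt_of_posDef hS,
    EuclideanSpace.real_norm_sq_eq, whiten, ofLp_toEuclideanCLM, ← Matrix.mulVec_mulVec,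
    Matrix.dotProduct_mulVec, ← Matrix.mulVec_transpose, Matrix.transpose_nonsing_inv,
    sqrt_transpose]
  simp [dotProduct, sq]

lemma map_sqrtCLM_stdGaussian {S : Matrix (Fin k) (Fin k) ℝ} (μ : Vec k) :
    multivariateGaussian μ S = (stdGaussian (Vec k)).map (fun z => μ + sqrtCLM S z) := rfl

lemma multivariateGaussian_smul {S : Matrix (Fin k) (Fin k) ℝ} (hS : S.PosDef) {c : ℝ}
    (hc : 0 ≤ c) :
    multivariateGaussian 0 (c • S) = (stdGaussian (Vec k)).map (fun z => √c • sqrtCLM S z) := by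
  rw [map_sqrtCLM_stdGaussian]
  simp only [sqrtCLM, sqrt_smul hS hc, map_smul, zero_add]
  rfl

/-- The density of the standard Gaussian measure. -/
def stdDensity (z : Vec k) : ENNReal :=
  ENNReal.ofReal ((√(2 * Real.pi))⁻¹ ^ k * Real.exp (-‖z‖ ^ 2 / 2))

lemma measurable_stdDensity : Measurable (stdDensity (k := k)) := by
  unfold stdDensity; fun_prop

lemma integrable_exp_neg_norm_sq :
    Integrable (fun z : Vec k => Real.exp (-‖z‖ ^ 2 / 2)) := by
  have h := (GaussianFourier.integrable_cexp_neg_mul_sq_norm_add (V := Vec k) (b := 1 / 2)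
    (by norm_num) 0 0).norm
  refine h.congr (ae_of_all _ fun z => ?_)
  have : (-(1 / 2 : ℂ) * (‖z‖ : ℂ) ^ 2 + 0 * ((inner ℝ (0 : Vec k) z : ℝ) : ℂ)) =
      ((-‖z‖ ^ 2 / 2 : ℝ) : ℂ) := by push_cast; ring
  simp only [this]
  rw [← Complex.ofReal_exp, Complex.norm_real, Real.norm_eq_abs, abs_of_pos (Real.exp_pos _)]

/-- Finite measures with equal characteristic functions coincide; on the density side this is the
Gaussian Fourier integral with parameter 1/2. -/
lemma stdGaussian_eq_withDensity :
    stdGaussian (Vec k) = (volume : Measure (Vec k)).withDensity stdDensity := by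
  have : IsFiniteMeasure ((volume : Measure (Vec k)).withDensity stdDensity) :=
    isFiniteMeasure_withDensity_ofReal (integrable_exp_neg_norm_sq.const_mul _).2
  refine Measure.ext_of_charFun (funext fun t => ?_)
  rw [charFun_stdGaussian, charFun_apply,
    integral_withDensity_eq_integral_toReal_smul measurable_stdDensity
      (ae_of_all _ fun _ => ENNReal.ofReal_lt_top)]
  have h := GaussianFourier.integral_cexp_neg_mul_sq_norm_add (V := Vec k) (b := 1 / 2)
    (by norm_num) Complex.I t
  have h2 : ∀ z : Vec k, (stdDensity z).toReal • Complex.exp ((inner ℝ z t : ℝ) * Complex.I) =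
      ((((√(2 * Real.pi))⁻¹ ^ k : ℝ)) : ℂ) * Complex.exp (-(1 / 2 : ℂ) * (‖z‖ : ℂ) ^ 2 +
        Complex.I * ((inner ℝ t z : ℝ) : ℂ)) := by
    intro z
    rw [stdDensity, ENNReal.toReal_ofReal (by positivity), Complex.real_smul, Complex.ofReal_mul,
      mul_assoc, Complex.ofReal_exp, ← Complex.exp_add, real_inner_comm]
    congr 2
    push_cast; ring
  simp_rw [h2]
  rw [integral_const_mul, h]
  have h3 : ((Real.pi : ℂ) / (1 / 2)) ^ (((Module.finrank ℝ (Vec k) : ℕ) : ℂ) / 2) =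
      ((√(2 * Real.pi) ^ k : ℝ) : ℂ) := by
    rw [finrank_euclideanSpace_fin, Real.sqrt_eq_rpow, ← Real.rpow_natCast, ← Real.rpow_mul
      (by positivity), Complex.ofReal_cpow (by positivity)]
    push_cast
    congr 1 <;> ring
  rw [h3, ← mul_assoc, ← Complex.ofReal_mul, ← mul_pow, inv_mul_cancel₀ (by positivity), one_pow,
    Complex.ofReal_one, one_mul]
  congr 1
  rw [Complex.I_sq]; ring

end GlobalLocal

end

/-! ### Gaussian conjugacy, masses of balls, chi-square quantiles. -/

noncomputable section

namespace GlobalLocal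

variable {k : ℕ}

lemma lintegral_comp_add_smul (F : Vec k → ENNReal) (hF : Measurable F) (v : Vec k) {c : ℝ}
    (hc : 0 < c) : ∫⁻ z, F z = ENNReal.ofReal (c ^ k) * ∫⁻ w, F (v + c • w) := by
  have h1 : ∫⁻ w, F (v + c • w) = ∫⁻ z, F (v + z) ∂(volume.map (fun w : Vec k => c • w)) := by
    rw [lintegral_map (by fun_prop) (by fun_prop)]
  rw [h1, Measure.map_addHaar_smul volume hc.ne', lintegral_smul_measure,
    lintegral_add_left_eq_self, finrank_euclideanSpace_fin, abs_of_pos (by positivity), smul_eq_mul,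
    ← mul_assoc, ← ENNReal.ofReal_mul (by positivity), mul_inv_cancel₀ (by positivity),
    ENNReal.ofReal_one, one_mul]

/-- The shrinkage factor `κ / (1 + κ)`. -/
def shrink (κ : ℝ) : ℝ := κ / (1 + κ)

/-- The marginal likelihood of `κ` at squared norm `t`, up to a constant. -/
def marginal (k : ℕ) (t κ : ℝ) : ℝ := (√(1 + κ))⁻¹ ^ k * Real.exp (-(t / (2 * (1 + κ))))

/-- Completing the square: conjugacy of the Gaussian prior with the Gaussian likelihood. -/
lemma lintegral_gaussian_conjugate {κ : ℝ} (hκ : 0 < κ) (y : Vec k) (g : Vec k → ENNReal)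
    (hg : Measurable g) :
    ∫⁻ z, g (√κ • z) * ENNReal.ofReal (Real.exp (-‖y - √κ • z‖ ^ 2 / 2)) ∂(stdGaussian (Vec k)) =
      ENNReal.ofReal (marginal k (‖y‖ ^ 2) κ) *
        ∫⁻ w, g (shrink κ • y + √(shrink κ) • w) ∂(stdGaussian (Vec k)) := by
  have h1 : 0 < 1 + κ := by linarith
  -- The substitution z = (√κ/(1+κ)) y + (1+κ)^(-1/2) w recentres at the posterior: √κ z becomes s y
  -- + √s w with s = `shrink κ`, and the Jacobian is the power factor of `marginal`.
  rw [stdGaussian_eq_withDensity, lintegral_withDensity_eq_lintegral_mul _ measurable_stdDensity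
      (by fun_prop), lintegral_withDensity_eq_lintegral_mul _ measurable_stdDensity
      (by fun_prop), lintegral_comp_add_smul _
      (by have := measurable_stdDensity (k := k); fun_prop) ((√κ / (1 + κ)) • y)
      (c := (√(1 + κ))⁻¹) (by positivity), marginal,
      ENNReal.ofReal_mul (p := (√(1 + κ))⁻¹ ^ k) (by positivity), mul_assoc,
      ← lintegral_const_mul (ENNReal.ofReal (Real.exp _))
        (by have := measurable_stdDensity (k := k); fun_prop)]
  congr 1
  refine lintegral_congr fun w => ?_
  have e1 : √κ • ((√κ / (1 + κ)) • y + (√(1 + κ))⁻¹ • w) =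
      shrink κ • y + √(shrink κ) • w := by
    rw [smul_add, smul_smul, smul_smul, shrink, Real.sqrt_div hκ.le, ← mul_div_assoc,
      Real.mul_self_sqrt hκ.le, div_eq_mul_inv (√κ)]
  simp only [Pi.mul_apply, e1, stdDensity]
  rw [mul_comm (g _), ← mul_assoc, ← mul_assoc, ← ENNReal.ofReal_mul (by positivity),
    ← ENNReal.ofReal_mul (by positivity)]
  congr 2
  rw [mul_comm (Real.exp _), mul_assoc, mul_assoc, ← Real.exp_add, ← Real.exp_add]
  congr 2
  have hs : √(shrink κ) ^ 2 = κ / (1 + κ) := Real.sq_sqrt (by unfold shrink; positivity)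
  have hs2 : √κ ^ 2 = κ := Real.sq_sqrt hκ.le
  have hs3 : √(1 + κ) ^ 2 = 1 + κ := Real.sq_sqrt h1.le
  have e2 : y - (shrink κ • y + √(shrink κ) • w) = (1 + κ)⁻¹ • y - √(shrink κ) • w := by
    rw [← sub_sub]; congr 1
    rw [show (1 + κ)⁻¹ = 1 - shrink κ by rw [shrink]; field_simp; ring, sub_smul, one_smul]
  rw [e2, norm_add_sq_real, norm_sub_sq_real]
  simp only [norm_smul, inner_smul_left, inner_smul_right, mul_pow, Real.norm_eq_abs, sq_abs, hs,
    inv_pow, hs3, div_pow, hs2, conj_trivial]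
  have e3 : √(shrink κ) = √κ * (√(1 + κ))⁻¹ := by
    rw [shrink, Real.sqrt_div hκ.le, div_eq_mul_inv]
  rw [e3]
  field_simp
  ring

/-- Among translates, a centred ball has the largest standard Gaussian mass. -/
lemma stdGaussian_ball_translate_le (v : Vec k) (r : ℝ) :
    stdGaussian (Vec k) {z | ‖v + z‖ ≤ r} ≤ stdGaussian (Vec k) {z | ‖z‖ ≤ r} := by
  set A : Set (Vec k) := {z | ‖v + z‖ ≤ r} with hA
  set B : Set (Vec k) := {z | ‖z‖ ≤ r} with hB
  have mA : MeasurableSet A := measurableSet_le (by fun_prop) (by fun_prop)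
  have mB : MeasurableSet B := measurableSet_le (by fun_prop) (by fun_prop)
  have hvol : volume A = volume B := by
    have : A = (fun z => v + z) ⁻¹' B := rfl
    rw [this, measure_preimage_add]
  have hBfin : volume B ≠ ⊤ := by
    have : B = Metric.closedBall 0 r := by ext; simp [hB]
    rw [this]; exact measure_closedBall_lt_top.ne
  have hdiff : volume (A \ B) = volume (B \ A) := by
    have a1 := measure_inter_add_sdiff (μ := volume) A mB
    have a2 := measure_inter_add_sdiff (μ := volume) B mA
    rw [Set.inter_comm] at a2
    rw [← a2, ← a1] at hvol
    have hfin : volume (A ∩ B) ≠ ⊤ := ne_top_of_le_ne_top hBfin (measure_mono Set.inter_subset_right)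
    exact (ENNReal.add_right_inj hfin).1 hvol
  -- `A \ B` and `B \ A` have equal volume, and c is the density on the sphere of radius r: the
  -- density is at most c outside `B` and at least c inside.
  set c : ENNReal := ENNReal.ofReal ((√(2 * Real.pi))⁻¹ ^ k * Real.exp (-r ^ 2 / 2)) with hc
  have up : stdGaussian (Vec k) (A \ B) ≤ c * volume (A \ B) := by
    rw [stdGaussian_eq_withDensity, withDensity_apply _ (mA.diff mB), ← setLIntegral_const]
    refine setLIntegral_mono measurable_const fun z hz => ?_
    refine ENNReal.ofReal_le_ofReal ?_
    have h1 : r < ‖z‖ := not_le.1 hz.2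
    have h0 : 0 ≤ r := (norm_nonneg _).trans hz.1
    gcongr
  have low : c * volume (B \ A) ≤ stdGaussian (Vec k) (B \ A) := by
    rw [stdGaussian_eq_withDensity, withDensity_apply _ (mB.diff mA), ← setLIntegral_const]
    refine setLIntegral_mono measurable_stdDensity fun z hz => ?_
    refine ENNReal.ofReal_le_ofReal ?_
    have h1 : ‖z‖ ≤ r := hz.1
    gcongr
  rw [← measure_inter_add_sdiff A mB, ← measure_inter_add_sdiff B mA, Set.inter_comm B A]
  refine add_le_add le_rfl (up.trans ?_)
  rw [hdiff]
  exact low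

lemma stdGaussian_smul_ball_le (v : Vec k) {c r : ℝ} (hc : 0 < c) :
    stdGaussian (Vec k) {z | ‖v + c • z‖ ≤ r} ≤ stdGaussian (Vec k) {z | ‖z‖ ≤ r / c} := by
  have : {z : Vec k | ‖v + c • z‖ ≤ r} = {z | ‖c⁻¹ • v + z‖ ≤ r / c} := by
    ext z
    have : v + c • z = c • (c⁻¹ • v + z) := by rw [smul_add, smul_smul, mul_inv_cancel₀ hc.ne', one_smul]
    simp only [Set.mem_ofPred_eq]
    rw [this, norm_smul, Real.norm_eq_abs, abs_of_pos hc, le_div_iff₀ hc, mul_comm]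
  rw [this]
  exact stdGaussian_ball_translate_le _ _

/-- The distribution function of `‖Z‖²` for standard Gaussian `Z`. -/
def normSqCdf (k : ℕ) (t : ℝ) : ℝ := (stdGaussian (Vec k)).real {z | ‖z‖ ^ 2 ≤ t}

lemma normSqCdf_mono : Monotone (normSqCdf k) := fun _ _ h =>
  measureReal_mono (fun _ hz => le_trans hz h)

lemma measurableSet_norm_sq_le (t : ℝ) : MeasurableSet {z : Vec k | ‖z‖ ^ 2 ≤ t} :=
  measurableSet_le (by fun_prop) (by fun_prop)

lemma chiSqLaw_real_Iic (t : ℝ) : (chiSqLaw k).real (Set.Iic t) = normSqCdf k t := by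
  rw [chiSqLaw, normSqCdf, ← map_pi_eq_stdGaussian,
    map_measureReal_apply (by fun_prop) measurableSet_Iic,
    map_measureReal_apply (by fun_prop) (measurableSet_norm_sq_le t)]
  congr 1
  ext z
  simp [EuclideanSpace.real_norm_sq_eq]

lemma tendsto_normSqCdf_atTop : Tendsto (normSqCdf k) atTop (𝓝 1) := by
  have h := tendsto_measure_iUnion_atTop (μ := stdGaussian (Vec k))
    (s := fun t : ℝ => {z : Vec k | ‖z‖ ^ 2 ≤ t}) (fun _ _ h _ hz => le_trans hz h)
  have hu : (⋃ t : ℝ, {z : Vec k | ‖z‖ ^ 2 ≤ t}) = Set.univ :=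
    Set.eq_univ_of_forall fun z => Set.mem_iUnion.2 ⟨‖z‖ ^ 2, le_refl (‖z‖ ^ 2)⟩
  rw [hu, measure_univ] at h
  exact (ENNReal.tendsto_toReal ENNReal.one_ne_top).comp h

/-- The balls decrease to the origin, which is a null set only because `k > 0`. -/
lemma tendsto_normSqCdf_zero (hk : 0 < k) : Tendsto (normSqCdf k) (𝓝[>] 0) (𝓝 0) := by
  have : NeZero k := ⟨hk.ne'⟩
  have h := tendsto_measure_biInter_gt (μ := stdGaussian (Vec k)) (a := (0 : ℝ))
    (s := fun t : ℝ => {z : Vec k | ‖z‖ ^ 2 ≤ t})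
    (fun t _ => (measurableSet_norm_sq_le t).nullMeasurableSet)
    (fun _ _ _ h _ hz => le_trans hz h) ⟨1, one_pos, measure_ne_top _ _⟩
  have hu : (⋂ t : ℝ, ⋂ (_ : t > 0), {z : Vec k | ‖z‖ ^ 2 ≤ t}) ⊆ {0} := by
    intro z hz
    simp only [Set.mem_iInter, Set.mem_ofPred_eq] at hz
    have : ‖z‖ ^ 2 ≤ 0 := le_of_forall_gt_imp_ge_of_dense hz
    simpa using le_antisymm this (by positivity)
  have h0 : stdGaussian (Vec k) {0} = 0 := by
    rw [stdGaussian_eq_withDensity]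
    exact withDensity_absolutelyContinuous _ _ (measure_singleton _)
  rw [measure_mono_null hu h0] at h
  exact (ENNReal.tendsto_toReal ENNReal.zero_ne_top).comp h

lemma normSqCdf_quantile_set_nonempty {p : ℝ} (hp : 0 < p) :
    {t : ℝ | 0 ≤ t ∧ 1 - p ≤ (chiSqLaw k).real (Set.Iic t)}.Nonempty := by
  simp_rw [chiSqLaw_real_Iic]
  obtain ⟨t, h1, h2⟩ := ((tendsto_normSqCdf_atTop (k := k)).eventually_const_le
    (show 1 - p < 1 by linarith) |>.and (eventually_ge_atTop 0)).exists
  exact ⟨t, h2, h1⟩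

lemma chiSqUpper_nonneg (p : ℝ) : 0 ≤ chiSqUpper k p := Real.sInf_nonneg fun _ h => h.1

/-- Strict inequalities on either side of the quantile, here and in the next lemma, make continuity
of the distribution function at the quantile unnecessary. -/
lemma le_normSqCdf_of_chiSqUpper_lt {p t : ℝ} (hp : 0 < p) (ht : chiSqUpper k p < t) :
    1 - p ≤ normSqCdf k t := by
  obtain ⟨s, ⟨_, hs⟩, hst⟩ := exists_lt_of_csInf_lt (normSqCdf_quantile_set_nonempty hp) ht
  rw [chiSqLaw_real_Iic] at hs
  exact hs.trans (normSqCdf_mono hst.le)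

lemma normSqCdf_lt_of_lt_chiSqUpper {p t : ℝ} (h0 : 0 ≤ t) (ht : t < chiSqUpper k p) :
    normSqCdf k t < 1 - p := by
  by_contra! h
  have hmem : t ∈ {t : ℝ | 0 ≤ t ∧ 1 - p ≤ (chiSqLaw k).real (Set.Iic t)} :=
    ⟨h0, by rwa [chiSqLaw_real_Iic]⟩
  exact (csInf_le ⟨0, fun _ h => h.1⟩ hmem).not_gt ht

lemma chiSqUpper_pos (hk : 0 < k) {p : ℝ} (hp : 0 < p) (hp1 : p < 1) : 0 < chiSqUpper k p := by
  obtain ⟨t, h1, h2⟩ := ((tendsto_normSqCdf_zero hk).eventually_lt_const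
    (show 0 < 1 - p by linarith) |>.and self_mem_nhdsWithin).exists
  refine lt_of_lt_of_le h2 (le_csInf (normSqCdf_quantile_set_nonempty hp) fun s hs => ?_)
  by_contra! hst
  have := hs.2
  rw [chiSqLaw_real_Iic] at this
  exact absurd (this.trans (normSqCdf_mono hst.le)) (not_le.2 h1)

end GlobalLocal

end

/-! ### The prior and the posterior as Gaussian scale mixtures. -/

noncomputable section

namespace GlobalLocal

variable {k : ℕ}

lemma isProbabilityMeasure_localLaw {a K : ℝ} {ℓ : ℝ → ℝ} (h : IsLocalPrior a K ℓ) :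
    IsProbabilityMeasure (localLaw a K ℓ) := ⟨h.proper⟩

lemma ae_localLaw_pos (a K : ℝ) (ℓ : ℝ → ℝ) : ∀ᵐ u ∂(localLaw a K ℓ), 0 < u :=
  (withDensity_absolutelyContinuous _ _).ae_le (ae_restrict_mem measurableSet_Ioi)

lemma measurable_marginal (t τ : ℝ) : Measurable (fun u => marginal k t (u * τ)) := by
  unfold marginal; fun_prop

lemma measurable_shrink (τ : ℝ) : Measurable (fun u => shrink (u * τ)) := by
  unfold shrink; fun_prop

lemma marginal_pos {κ : ℝ} (hκ : 0 ≤ κ) (t : ℝ) : 0 < marginal k t κ := by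
  unfold marginal; positivity

/-- The map sending a scale `u` and a standard Gaussian `z` to a draw from the prior. -/
def priorDraw (S : Matrix (Fin k) (Fin k) ℝ) (τ : ℝ) (p : ℝ × Vec k) : Vec k :=
  √(p.1 * τ) • sqrtCLM S p.2

/-- The map sending a scale `u` and a standard Gaussian `z` to a draw from the posterior. -/
def postDraw (S : Matrix (Fin k) (Fin k) ℝ) (τ : ℝ) (x : Vec k) (p : ℝ × Vec k) : Vec k :=
  shrink (p.1 * τ) • x + √(shrink (p.1 * τ)) • sqrtCLM S p.2

lemma measurable_priorDraw (S : Matrix (Fin k) (Fin k) ℝ) (τ : ℝ) :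
    Measurable (priorDraw S τ) := by
  unfold priorDraw; fun_prop

lemma measurable_postDraw (S : Matrix (Fin k) (Fin k) ℝ) (τ : ℝ) (x : Vec k) :
    Measurable (postDraw S τ x) := by
  unfold postDraw shrink; fun_prop

lemma priorLaw_eq_map {S : Matrix (Fin k) (Fin k) ℝ} (hS : S.PosDef) {a K τ : ℝ} {ℓ : ℝ → ℝ}
    (h : IsLocalPrior a K ℓ) (hτ : 0 < τ) :
    priorLaw S a K ℓ τ =
      ((localLaw a K ℓ).prod (stdGaussian (Vec k))).map (priorDraw S τ) := by
  have := isProbabilityMeasure_localLaw h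
  -- The square root of `(u * τ) • S` factors only when `u * τ` is nonnegative, so the kernel is
  -- replaced almost everywhere; the replacement is visibly measurable in `u`.
  have hcongr : (fun u => multivariateGaussian 0 ((u * τ) • S)) =ᵐ[localLaw a K ℓ]
      fun u => (stdGaussian (Vec k)).map (fun z => priorDraw S τ (u, z)) := by
    filter_upwards [ae_localLaw_pos a K ℓ] with u hu
    exact multivariateGaussian_smul hS (by positivity)
  have hm : Measurable
      fun u : ℝ => (stdGaussian (Vec k)).map (fun z => priorDraw S τ (u, z)) := by
    refine Measure.measurable_of_measurable_coe _ fun B hB => ?_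
    have : ∀ u, (stdGaussian (Vec k)).map (fun z => priorDraw S τ (u, z)) B =
        stdGaussian (Vec k) (Prod.mk u ⁻¹' (priorDraw S τ ⁻¹' B)) := fun u =>
      Measure.map_apply ((measurable_priorDraw S τ).comp measurable_prodMk_left) hB
    simp_rw [this]
    exact measurable_measure_prodMk_left (measurable_priorDraw S τ hB)
  rw [priorLaw, Measure.bind_congr_right hcongr]
  ext B hB
  rw [Measure.bind_apply hB hm.aemeasurable, Measure.map_apply (measurable_priorDraw S τ) hB,
    Measure.prod_apply (measurable_priorDraw S τ hB)]
  refine lintegral_congr fun u => ?_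
  exact Measure.map_apply ((measurable_priorDraw S τ).comp measurable_prodMk_left) hB

/-- The evidence: the prior mean of the marginal likelihood. -/
def evidence (k : ℕ) (a K : ℝ) (ℓ : ℝ → ℝ) (τ t : ℝ) : ENNReal :=
  ∫⁻ u, ENNReal.ofReal (marginal k t (u * τ)) ∂(localLaw a K ℓ)

/-- The posterior law of the local scale. -/
def postScale (k : ℕ) (a K : ℝ) (ℓ : ℝ → ℝ) (τ t : ℝ) : Measure ℝ :=
  (evidence k a K ℓ τ t)⁻¹ •
    (localLaw a K ℓ).withDensity (fun u => ENNReal.ofReal (marginal k t (u * τ)))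

lemma marginal_le_one {κ t : ℝ} (hκ : 0 ≤ κ) (ht : 0 ≤ t) : marginal k t κ ≤ 1 := by
  have h1 : (√(1 + κ))⁻¹ ≤ 1 := inv_le_one_of_one_le₀ (Real.one_le_sqrt.2 (by linarith))
  have h2 : Real.exp (-(t / (2 * (1 + κ)))) ≤ 1 := Real.exp_le_one_iff.2 (by
    have : 0 ≤ t / (2 * (1 + κ)) := by positivity
    linarith)
  exact mul_le_one₀ (pow_le_one₀ (by positivity) h1) (by positivity) h2

lemma evidence_ne_top {a K τ t : ℝ} {ℓ : ℝ → ℝ} (h : IsLocalPrior a K ℓ) (hτ : 0 < τ)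
    (ht : 0 ≤ t) : evidence k a K ℓ τ t ≠ ⊤ := by
  have := isProbabilityMeasure_localLaw h
  refine ne_top_of_le_ne_top ENNReal.one_ne_top
    ((lintegral_mono_ae (g := fun _ => 1) ?_).trans_eq (by simp))
  filter_upwards [ae_localLaw_pos a K ℓ] with u hu
  exact ENNReal.ofReal_le_one.2 (marginal_le_one (by positivity) ht)

lemma evidence_ne_zero {a K τ t : ℝ} {ℓ : ℝ → ℝ} (h : IsLocalPrior a K ℓ) (hτ : 0 < τ) :
    evidence k a K ℓ τ t ≠ 0 := by
  have := isProbabilityMeasure_localLaw h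
  intro h0
  rw [evidence, lintegral_eq_zero_iff (measurable_marginal t τ).ennreal_ofReal] at h0
  have : ∀ᵐ u ∂(localLaw a K ℓ), False := by
    filter_upwards [ae_localLaw_pos a K ℓ, h0] with u hu h1
    have := marginal_pos (k := k) (κ := u * τ) (by positivity) t
    simp only [Pi.zero_apply, ENNReal.ofReal_eq_zero] at h1
    linarith
  exact this.exists.elim fun _ => id

lemma isProbabilityMeasure_postScale {a K τ t : ℝ} {ℓ : ℝ → ℝ} (h : IsLocalPrior a K ℓ)
    (hτ : 0 < τ) (ht : 0 ≤ t) : IsProbabilityMeasure (postScale k a K ℓ τ t) := by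
  refine ⟨?_⟩
  rw [postScale, Measure.smul_apply, withDensity_apply _ MeasurableSet.univ, setLIntegral_univ,
    smul_eq_mul]
  exact ENNReal.inv_mul_cancel (evidence_ne_zero h hτ) (evidence_ne_top h hτ ht)

lemma normalDensity_eq {S : Matrix (Fin k) (Fin k) ℝ} (hS : S.PosDef) (θ x : Vec k) :
    normalDensity S θ x = (√((2 * Real.pi) ^ k * S.det))⁻¹ *
      Real.exp (-‖whiten S x - whiten S θ‖ ^ 2 / 2) := by
  rw [normalDensity, mahalSq_eq hS, map_sub]

/-- Bayes' formula before normalization. -/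
lemma priorLaw_withDensity {S : Matrix (Fin k) (Fin k) ℝ} (hS : S.PosDef) {a K τ : ℝ} {ℓ : ℝ → ℝ}
    (h : IsLocalPrior a K ℓ) (hτ : 0 < τ) (x : Vec k) :
    (priorLaw S a K ℓ τ).withDensity (fun θ => ENNReal.ofReal (normalDensity S θ x)) =
      ENNReal.ofReal (√((2 * Real.pi) ^ k * S.det))⁻¹ •
        (((localLaw a K ℓ).withDensity
          (fun u => ENNReal.ofReal (marginal k (‖whiten S x‖ ^ 2) (u * τ)))).prod
            (stdGaussian (Vec k))).map (postDraw S τ x) := by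
  have := isProbabilityMeasure_localLaw h
  have hmd : Measurable (fun θ : Vec k => ENNReal.ofReal (normalDensity S θ x)) := by
    simp_rw [normalDensity_eq hS]; fun_prop
  have hmm := (measurable_marginal (k := k) (‖whiten S x‖ ^ 2) τ).ennreal_ofReal
  ext B hB
  have hpre : MeasurableSet (postDraw S τ x ⁻¹' B) := measurable_postDraw S τ x hB
  rw [withDensity_apply _ hB, ← lintegral_indicator hB, priorLaw_eq_map hS h hτ,
    lintegral_map (hmd.indicator hB) (measurable_priorDraw S τ),
    lintegral_prod (fun p => B.indicator _ (priorDraw S τ p))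
      ((hmd.indicator hB).comp (measurable_priorDraw S τ)).aemeasurable,
    Measure.smul_apply, Measure.map_apply (measurable_postDraw S τ x) hB,
    Measure.prod_apply hpre,
    lintegral_withDensity_eq_lintegral_mul _ hmm (measurable_measure_prodMk_left hpre), smul_eq_mul,
    ← lintegral_const_mul _ (hmm.mul (measurable_measure_prodMk_left hpre))]
  refine lintegral_congr_ae ?_
  filter_upwards [ae_localLaw_pos a K ℓ] with u hu
  have hκ : 0 < u * τ := by positivity
  -- For each fixed scale, conjugacy is tested on the indicator of the event `B` in whitened
  -- coordinates.
  have hg : Measurable ((sqrtCLM S ⁻¹' B).indicator (fun _ => (1 : ENNReal))) :=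
    measurable_const.indicator ((sqrtCLM S).continuous.measurable hB)
  have key := lintegral_gaussian_conjugate hκ (whiten S x) _ hg
  have e1 : ∀ z, B.indicator (fun θ => ENNReal.ofReal (normalDensity S θ x))
      (priorDraw S τ (u, z)) = ENNReal.ofReal (√((2 * Real.pi) ^ k * S.det))⁻¹ *
      ((sqrtCLM S ⁻¹' B).indicator (fun _ => (1 : ENNReal)) (√(u * τ) • z) *
        ENNReal.ofReal (Real.exp (-‖whiten S x - √(u * τ) • z‖ ^ 2 / 2))) := by
    intro z
    have hz : priorDraw S τ (u, z) = sqrtCLM S (√(u * τ) • z) := by rw [priorDraw, map_smul]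
    by_cases hzB : sqrtCLM S (√(u * τ) • z) ∈ B
    · rw [hz, Set.indicator_of_mem hzB, Set.indicator_of_mem (s := sqrtCLM S ⁻¹' B) hzB, one_mul,
        normalDensity_eq hS, whiten_sqrtCLM hS, ENNReal.ofReal_mul (by positivity)]
    · rw [hz, Set.indicator_of_notMem hzB, Set.indicator_of_notMem (s := sqrtCLM S ⁻¹' B) hzB,
        zero_mul, mul_zero]
  simp_rw [e1]
  rw [lintegral_const_mul _ (by fun_prop), key]
  congr 2
  beta_reduce
  rw [← lintegral_indicator_one (measurable_prodMk_left hpre)]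
  refine lintegral_congr fun w => ?_
  have : postDraw S τ x (u, w) = sqrtCLM S (shrink (u * τ) • whiten S x + √(shrink (u * τ)) • w) := by
    rw [postDraw, map_add, map_smul, map_smul, sqrtCLM_whiten hS]
  by_cases hw : postDraw S τ x (u, w) ∈ B
  · rw [Set.indicator_of_mem (s := Prod.mk u ⁻¹' (postDraw S τ x ⁻¹' B)) hw]
    rw [this] at hw
    exact Set.indicator_of_mem (s := sqrtCLM S ⁻¹' B) hw _
  · rw [Set.indicator_of_notMem (s := Prod.mk u ⁻¹' (postDraw S τ x ⁻¹' B)) hw]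
    rw [this] at hw
    exact Set.indicator_of_notMem (s := sqrtCLM S ⁻¹' B) hw _

/-- The posterior as a mixture of Gaussian laws over the posterior law of the local scale. -/
lemma posteriorLaw_eq_map {S : Matrix (Fin k) (Fin k) ℝ} (hS : S.PosDef) {a K τ : ℝ} {ℓ : ℝ → ℝ}
    (h : IsLocalPrior a K ℓ) (hτ : 0 < τ) (x : Vec k) :
    posteriorLaw S a K ℓ τ x =
      ((postScale k a K ℓ τ (‖whiten S x‖ ^ 2)).prod (stdGaussian (Vec k))).map
        (postDraw S τ x) := by
  have := isProbabilityMeasure_localLaw h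
  set c := ENNReal.ofReal (√((2 * Real.pi) ^ k * S.det))⁻¹ with hc
  have hc0 : c ≠ 0 := by
    have := hS.det_pos
    rw [hc]; simp only [ne_eq, ENNReal.ofReal_eq_zero, not_le]; positivity
  have hden : ∫⁻ θ, ENNReal.ofReal (normalDensity S θ x) ∂(priorLaw S a K ℓ τ) =
      c * evidence k a K ℓ τ (‖whiten S x‖ ^ 2) := by
    have := congrArg (fun μ => μ Set.univ) (priorLaw_withDensity hS h hτ x)
    simp only [withDensity_apply _ MeasurableSet.univ, setLIntegral_univ, Measure.smul_apply,
      Measure.map_apply (measurable_postDraw S τ x) MeasurableSet.univ, Set.preimage_univ,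
      smul_eq_mul] at this
    rw [this, ← Set.univ_prod_univ, Measure.prod_prod,
      measure_univ (μ := stdGaussian (Vec k)), mul_one,
      withDensity_apply _ MeasurableSet.univ, setLIntegral_univ]
    rfl
  rw [posteriorLaw, priorLaw_withDensity hS h hτ, hden, smul_smul, postScale,
    Measure.prod_smul_left, Measure.map_smul]
  congr 1
  rw [ENNReal.mul_inv (Or.inl hc0) (Or.inl ENNReal.ofReal_ne_top), mul_right_comm,
    ENNReal.inv_mul_cancel hc0 ENNReal.ofReal_ne_top, one_mul]

end GlobalLocal

end

/-! ### The posterior mean, and upper and lower bounds for the credible radius. -/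

noncomputable section

namespace GlobalLocal

variable {k : ℕ}

/-- The posterior mean of the shrinkage factor. -/
def shrinkMean (k : ℕ) (a K : ℝ) (ℓ : ℝ → ℝ) (τ t : ℝ) : ℝ :=
  ∫ u, shrink (u * τ) ∂(postScale k a K ℓ τ t)

lemma shrink_pos {κ : ℝ} (hκ : 0 < κ) : 0 < shrink κ := by unfold shrink; positivity

lemma shrink_lt_one {κ : ℝ} (hκ : 0 < κ) : shrink κ < 1 := by
  rw [shrink, div_lt_one (by linarith)]; linarith

lemma one_sub_shrink {κ : ℝ} (hκ : 0 < κ) : 1 - shrink κ = (1 + κ)⁻¹ := by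
  rw [shrink]; field_simp; ring

lemma ae_postScale_pos (k : ℕ) (a K : ℝ) (ℓ : ℝ → ℝ) (τ t : ℝ) :
    ∀ᵐ u ∂(postScale k a K ℓ τ t), 0 < u := by
  refine Measure.ae_smul_measure ?_ _
  exact (withDensity_absolutelyContinuous _ _).ae_le (ae_localLaw_pos a K ℓ)

variable {S : Matrix (Fin k) (Fin k) ℝ} {a K τ t : ℝ} {ℓ : ℝ → ℝ}

lemma integrable_shrink (h : IsLocalPrior a K ℓ) (hτ : 0 < τ) (ht : 0 ≤ t) :
    Integrable (fun u => shrink (u * τ)) (postScale k a K ℓ τ t) := by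
  have := isProbabilityMeasure_postScale (k := k) h hτ ht
  refine Integrable.of_bound (measurable_shrink τ).aestronglyMeasurable 1 ?_
  filter_upwards [ae_postScale_pos k a K ℓ τ t] with u hu
  have hκ : 0 < u * τ := by positivity
  rw [Real.norm_eq_abs, abs_of_pos (shrink_pos hκ)]
  exact (shrink_lt_one hκ).le

lemma shrinkMean_nonneg (hτ : 0 < τ) : 0 ≤ shrinkMean k a K ℓ τ t := by
  refine integral_nonneg_of_ae ?_
  filter_upwards [ae_postScale_pos k a K ℓ τ t] with u hu
  exact (shrink_pos (by positivity)).le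

lemma shrinkMean_le_one (h : IsLocalPrior a K ℓ) (hτ : 0 < τ) (ht : 0 ≤ t) :
    shrinkMean k a K ℓ τ t ≤ 1 := by
  have := isProbabilityMeasure_postScale (k := k) h hτ ht
  refine (integral_mono_ae (integrable_shrink h hτ ht) (integrable_const 1) ?_).trans_eq (by simp)
  filter_upwards [ae_postScale_pos k a K ℓ τ t] with u hu
  exact (shrink_lt_one (by positivity)).le

/-- In a posterior draw the Gaussian noise is centred and independent of the scale, so its
contribution integrates to zero. -/
lemma posteriorMean_eq (hS : S.PosDef) (h : IsLocalPrior a K ℓ) (hτ : 0 < τ) (x : Vec k) :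
    posteriorMean S a K ℓ τ x = shrinkMean k a K ℓ τ (‖whiten S x‖ ^ 2) • x := by
  set t := ‖whiten S x‖ ^ 2 with ht
  have := isProbabilityMeasure_postScale (k := k) h hτ (t := t) (by positivity)
  have hint := integrable_shrink (k := k) h hτ (t := t) (by positivity)
  have hA : Integrable (fun z => sqrtCLM S z) (stdGaussian (Vec k)) :=
    (sqrtCLM S).integrable_comp IsGaussian.integrable_id
  have hsq : Integrable (fun u => √(shrink (u * τ))) (postScale k a K ℓ τ t) := by
    refine Integrable.of_bound (measurable_shrink τ).sqrt.aestronglyMeasurable 1 ?_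
    filter_upwards [ae_postScale_pos k a K ℓ τ t] with u hu
    rw [Real.norm_eq_abs, abs_of_nonneg (Real.sqrt_nonneg _), Real.sqrt_le_one]
    exact (shrink_lt_one (by positivity)).le
  rw [posteriorMean, posteriorLaw_eq_map hS h hτ,
    integral_map (measurable_postDraw S τ x).aemeasurable (by fun_prop)]
  unfold postDraw
  rw [integral_add ((hint.comp_fst _).smul_const x) (hsq.smul_prod hA),
    integral_smul_const, integral_prod_smul (fun u => √(shrink (u * τ))) (fun z => sqrtCLM S z),
    (sqrtCLM S).integral_comp_comm IsGaussian.integrable_fun_id, integral_id_stdGaussian, map_zero,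
    smul_zero, add_zero, integral_fun_fst (fun u => shrink (u * τ))]
  simp [shrinkMean]

/-- The deviation of a posterior draw from the posterior mean, in whitened coordinates. -/
def dev (m τ : ℝ) (y : Vec k) (p : ℝ × Vec k) : Vec k :=
  (shrink (p.1 * τ) - m) • y + √(shrink (p.1 * τ)) • p.2

lemma measurable_dev (m τ : ℝ) (y : Vec k) : Measurable (dev m τ y) := by
  unfold dev shrink; fun_prop

lemma posteriorLaw_real_ball (hS : S.PosDef) (h : IsLocalPrior a K ℓ) (hτ : 0 < τ) (x : Vec k)
    (r : ℝ) :
    (posteriorLaw S a K ℓ τ x).real {θ | mahalSq S (θ - posteriorMean S a K ℓ τ x) ≤ r} =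
      ((postScale k a K ℓ τ (‖whiten S x‖ ^ 2)).prod (stdGaussian (Vec k))).real
        {p | ‖dev (shrinkMean k a K ℓ τ (‖whiten S x‖ ^ 2)) τ (whiten S x) p‖ ^ 2 ≤ r} := by
  have hm : MeasurableSet {θ : Vec k | mahalSq S (θ - posteriorMean S a K ℓ τ x) ≤ r} := by
    simp_rw [mahalSq_eq hS]
    exact measurableSet_le (by fun_prop) (by fun_prop)
  rw [posteriorLaw_eq_map hS h hτ, map_measureReal_apply (measurable_postDraw S τ x) hm]
  congr 1
  ext p
  simp only [Set.mem_preimage, Set.mem_ofPred_eq, mahalSq_eq hS, posteriorMean_eq hS h hτ, dev,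
    postDraw, map_sub, map_add, map_smul, whiten_sqrtCLM hS, sub_smul]
  rw [add_sub_right_comm]

/-- The second moment of the standard Gaussian law. -/
def secondMoment (k : ℕ) : ℝ := ∫ z, ‖z‖ ^ 2 ∂(stdGaussian (Vec k))

lemma secondMoment_nonneg : 0 ≤ secondMoment k := integral_nonneg fun _ => by positivity

/-- The inequality (s - m)² ≤ s + m on [0, 1] makes the bound linear in s, so its expectation
involves the law of s only through its mean. -/
lemma norm_dev_sq_le {m τ : ℝ} (hm : 0 ≤ m) (hm1 : m ≤ 1) (y : Vec k) (p : ℝ × Vec k)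
    (hp : 0 < p.1 * τ) :
    ‖dev m τ y p‖ ^ 2 ≤
      2 * ‖y‖ ^ 2 * (shrink (p.1 * τ) + m) + 2 * (shrink (p.1 * τ) * ‖p.2‖ ^ 2) := by
  set s := shrink (p.1 * τ) with hs
  have s0 : 0 < s := shrink_pos hp
  have s1 : s < 1 := shrink_lt_one hp
  have h1 : ‖dev m τ y p‖ ≤ |s - m| * ‖y‖ + √s * ‖p.2‖ := by
    refine (norm_add_le _ _).trans_eq ?_
    rw [norm_smul, norm_smul, Real.norm_eq_abs, Real.norm_eq_abs, abs_of_nonneg (Real.sqrt_nonneg _)]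
  have h2 : ‖dev m τ y p‖ ^ 2 ≤ 2 * ((|s - m| * ‖y‖) ^ 2 + (√s * ‖p.2‖) ^ 2) :=
    (pow_le_pow_left₀ (norm_nonneg _) h1 2).trans (add_sq_le)
  rw [mul_pow, mul_pow, sq_abs, Real.sq_sqrt s0.le] at h2
  have h3 : (s - m) ^ 2 ≤ s + m := by nlinarith [mul_nonneg s0.le hm]
  nlinarith [mul_le_mul_of_nonneg_right h3 (sq_nonneg ‖y‖)]

/-- Markov's inequality for the majorant of `norm_dev_sq_le`, whose mean is the left side of `hb`.
-/
lemma one_sub_le_posteriorLaw_ball (hS : S.PosDef) (h : IsLocalPrior a K ℓ) (hτ : 0 < τ)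
    (x : Vec k) {r α : ℝ} (hr : 0 < r)
    (hb : shrinkMean k a K ℓ τ (‖whiten S x‖ ^ 2) *
      (4 * ‖whiten S x‖ ^ 2 + 2 * secondMoment k) ≤ α * r) :
    1 - α ≤ (posteriorLaw S a K ℓ τ x).real
      {θ | mahalSq S (θ - posteriorMean S a K ℓ τ x) ≤ r} := by
  rw [posteriorLaw_real_ball hS h hτ]
  set y := whiten S x
  have ht : 0 ≤ ‖y‖ ^ 2 := by positivity
  set m := shrinkMean k a K ℓ τ (‖y‖ ^ 2) with hm
  have := isProbabilityMeasure_postScale (k := k) h hτ ht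
  set P := (postScale k a K ℓ τ (‖y‖ ^ 2)).prod (stdGaussian (Vec k)) with hP
  have hint := integrable_shrink (k := k) h hτ ht
  have hz : Integrable (fun z : Vec k => ‖z‖ ^ 2) (stdGaussian (Vec k)) :=
    IsGaussian.memLp_two_id.integrable_norm_pow (by norm_num)
  have hi1 : Integrable (fun p : ℝ × Vec k => 2 * ‖y‖ ^ 2 * (shrink (p.1 * τ) + m)) P :=
    ((hint.comp_fst _).add (integrable_const m)).const_mul _
  have hi2 : Integrable (fun p : ℝ × Vec k => 2 * (shrink (p.1 * τ) * ‖p.2‖ ^ 2)) P :=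
    (hint.mul_prod hz).const_mul 2
  have hpos : ∀ᵐ p ∂P, 0 < p.1 * τ := by
    have : ∀ᵐ p ∂P, 0 < p.1 := Measure.quasiMeasurePreserving_fst.ae (ae_postScale_pos k a K ℓ τ _)
    filter_upwards [this] with p hp
    positivity
  have markov := mul_meas_ge_le_integral_of_nonneg (μ := P)
    (f := fun p => 2 * ‖y‖ ^ 2 * (shrink (p.1 * τ) + m) + 2 * (shrink (p.1 * τ) * ‖p.2‖ ^ 2))
    (by
      filter_upwards [hpos] with p hp
      have h1 := (shrink_pos hp).le
      have h2 : 0 ≤ m := shrinkMean_nonneg hτ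
      simp only [Pi.zero_apply]
      positivity) (hi1.add hi2) r
  have hval : ∫ p, (2 * ‖y‖ ^ 2 * (shrink (p.1 * τ) + m) + 2 * (shrink (p.1 * τ) * ‖p.2‖ ^ 2)) ∂P
      = m * (4 * ‖y‖ ^ 2 + 2 * secondMoment k) := by
    rw [integral_add hi1 hi2, integral_const_mul, integral_const_mul,
      integral_add (hint.comp_fst _) (integrable_const m),
      integral_prod_mul (fun u => shrink (u * τ)) (fun z : Vec k => ‖z‖ ^ 2),
      integral_fun_fst (fun u => shrink (u * τ))]
    simp only [probReal_univ, smul_eq_mul, one_mul, integral_const]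
    change 2 * ‖y‖ ^ 2 * (m + m) + 2 * (m * secondMoment k) = _
    ring
  rw [hval] at markov
  have hms : MeasurableSet {p | ‖dev m τ y p‖ ^ 2 ≤ r} :=
    measurableSet_le ((measurable_dev m τ y).norm.pow_const 2) (by fun_prop)
  have hc : P.real {p | ‖dev m τ y p‖ ^ 2 ≤ r}ᶜ ≤ α := by
    have h1 : P.real {p | ‖dev m τ y p‖ ^ 2 ≤ r}ᶜ ≤ P.real {p | r ≤ 2 * ‖y‖ ^ 2 *
        (shrink (p.1 * τ) + m) + 2 * (shrink (p.1 * τ) * ‖p.2‖ ^ 2)} := by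
      refine ENNReal.toReal_mono (measure_ne_top _ _) (measure_mono_ae ?_)
      filter_upwards [hpos] with p hp hpc
      have hpc' : ¬ ‖dev m τ y p‖ ^ 2 ≤ r := hpc
      exact (not_le.1 hpc').le.trans
        (norm_dev_sq_le (shrinkMean_nonneg hτ) (shrinkMean_le_one h hτ ht) y p hp)
    refine h1.trans (le_of_mul_le_mul_left ?_ hr)
    linarith
  rw [probReal_compl_eq_one_sub hms] at hc
  linarith

lemma credRadius_set_nonempty (hS : S.PosDef) (h : IsLocalPrior a K ℓ) (hτ : 0 < τ)
    (x : Vec k) {α : ℝ} (hα : 0 < α) :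
    {r : ℝ | 0 ≤ r ∧ 1 - α ≤ (posteriorLaw S a K ℓ τ x).real
      {θ | mahalSq S (θ - posteriorMean S a K ℓ τ x) ≤ r}}.Nonempty := by
  set b := shrinkMean k a K ℓ τ (‖whiten S x‖ ^ 2) *
      (4 * ‖whiten S x‖ ^ 2 + 2 * secondMoment k) with hb
  have hb0 : 0 ≤ b := by
    have := shrinkMean_nonneg (k := k) (a := a) (K := K) (ℓ := ℓ) (t := ‖whiten S x‖ ^ 2) hτ
    have := secondMoment_nonneg (k := k)
    positivity
  -- The `+ 1` keeps the radius positive even if `b` vanishes.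
  have hr : 0 < (b + 1) / α := by positivity
  refine ⟨(b + 1) / α, hr.le, one_sub_le_posteriorLaw_ball hS h hτ x hr ?_⟩
  rw [mul_div_cancel₀ _ hα.ne']
  linarith

lemma credRadius_nonneg (α : ℝ) (x : Vec k) : 0 ≤ credRadius S a K ℓ α τ x :=
  Real.sInf_nonneg fun _ h => h.1

lemma credRadius_le (hS : S.PosDef) (h : IsLocalPrior a K ℓ) (hτ : 0 < τ)
    (x : Vec k) {r α : ℝ} (hr : 0 < r)
    (hb : shrinkMean k a K ℓ τ (‖whiten S x‖ ^ 2) *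
      (4 * ‖whiten S x‖ ^ 2 + 2 * secondMoment k) ≤ α * r) :
    credRadius S a K ℓ α τ x ≤ r :=
  csInf_le ⟨0, fun _ h => h.1⟩ ⟨hr.le, one_sub_le_posteriorLaw_ball hS h hτ x hr hb⟩

/-- Condition on u. Scales with s < s₁ are charged in full; for s ≥ s₁ recentring the ball at the
mean of N((s - m) y, s I) only increases its mass, and r/s ≤ q/s₁. -/
lemma prod_real_ball_le (h : IsLocalPrior a K ℓ) (hτ : 0 < τ) (ht : 0 ≤ t) (m : ℝ) (y : Vec k)
    {r q s₁ : ℝ} (hr : 0 ≤ r) (hrq : r ≤ q) (hs₁ : 0 < s₁) :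
    ((postScale k a K ℓ τ t).prod (stdGaussian (Vec k))).real {p | ‖dev m τ y p‖ ^ 2 ≤ r} ≤
      (postScale k a K ℓ τ t).real {u | shrink (u * τ) < s₁} + normSqCdf k (q / s₁) := by
  have := isProbabilityMeasure_postScale (k := k) h hτ ht
  set N := postScale k a K ℓ τ t
  have hms : MeasurableSet {p | ‖dev m τ y p‖ ^ 2 ≤ r} :=
    measurableSet_le ((measurable_dev m τ y).norm.pow_const 2) (by fun_prop)
  have hmu : MeasurableSet {u | shrink (u * τ) < s₁} :=
    measurableSet_lt (measurable_shrink τ) measurable_const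
  have key : N.prod (stdGaussian (Vec k)) {p | ‖dev m τ y p‖ ^ 2 ≤ r} ≤
      N {u | shrink (u * τ) < s₁} + stdGaussian (Vec k) {z | ‖z‖ ^ 2 ≤ q / s₁} := by
    rw [Measure.prod_apply hms]
    calc _ ≤ ∫⁻ u, ({u | shrink (u * τ) < s₁}.indicator 1 u +
          stdGaussian (Vec k) {z | ‖z‖ ^ 2 ≤ q / s₁}) ∂N := by
          refine lintegral_mono fun u => ?_
          by_cases hu : u ∈ {u | shrink (u * τ) < s₁}
          · rw [Set.indicator_of_mem hu]
            exact (prob_le_one).trans le_self_add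
          · rw [Set.indicator_of_notMem hu, zero_add]
            have hu' : s₁ ≤ shrink (u * τ) := not_lt.1 hu
            have h0 : 0 < shrink (u * τ) := hs₁.trans_le hu'
            have hsub : Prod.mk u ⁻¹' {p | ‖dev m τ y p‖ ^ 2 ≤ r} ⊆
                {z | ‖(shrink (u * τ) - m) • y + √(shrink (u * τ)) • z‖ ≤ √r} := fun z hz =>
              Real.le_sqrt_of_sq_le hz
            refine (measure_mono hsub).trans ((stdGaussian_smul_ball_le _ (Real.sqrt_pos.2 h0)).trans
              (measure_mono fun z hz => ?_))
            have h3 := pow_le_pow_left₀ (norm_nonneg _) hz 2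
            rw [div_pow, Real.sq_sqrt hr, Real.sq_sqrt h0.le] at h3
            exact h3.trans (div_le_div₀ (hr.trans hrq) hrq hs₁ hu')
      _ = _ := by
          rw [lintegral_add_right _ measurable_const, lintegral_indicator_one hmu, lintegral_const,
            measure_univ, mul_one]
  have := ENNReal.toReal_mono (by finiteness) key
  rwa [ENNReal.toReal_add (measure_ne_top _ _) (measure_ne_top _ _)] at this

lemma le_credRadius (hS : S.PosDef) (h : IsLocalPrior a K ℓ) (hτ : 0 < τ)
    (x : Vec k) {q s₁ α : ℝ} (hα : 0 < α) (hs₁ : 0 < s₁)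
    (hb : (postScale k a K ℓ τ (‖whiten S x‖ ^ 2)).real {u | shrink (u * τ) < s₁} +
      normSqCdf k (q / s₁) < 1 - α) :
    q ≤ credRadius S a K ℓ α τ x := by
  refine le_csInf (credRadius_set_nonempty hS h hτ x hα) fun r hr => ?_
  by_contra! hrq
  have h1 := hr.2
  rw [posteriorLaw_real_ball hS h hτ] at h1
  have := prod_real_ball_le h hτ (t := ‖whiten S x‖ ^ 2) (by positivity)
    (shrinkMean k a K ℓ τ (‖whiten S x‖ ^ 2)) (whiten S x) hr.1 hrq.le hs₁
  linarith

/-- Probabilities under `X ∼ N(θ₀, S)` in terms of standard Gaussian noise. -/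
lemma normSqCdf_le_real (θ₀ : Vec k) (A : Set (Vec k)) {R : ℝ}
    (hA : ∀ z : Vec k, ‖z‖ ^ 2 ≤ R → θ₀ + sqrtCLM S z ∈ A) :
    normSqCdf k R ≤ (multivariateGaussian θ₀ S).real A := by
  rw [map_sqrtCLM_stdGaussian, normSqCdf]
  have hm : Measurable (fun z : Vec k => θ₀ + sqrtCLM S z) := by fun_prop
  have := isProbabilityMeasure_stdGaussian (E := Vec k)
  have hP := Measure.isProbabilityMeasure_map (μ := stdGaussian (Vec k)) hm.aemeasurable
  refine ENNReal.toReal_mono (measure_ne_top _ _) ?_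
  -- `Measure.le_map_apply` asks for no measurability of `A`, so measurability of the credible set
  -- in x never enters.
  exact (measure_mono hA).trans (Measure.le_map_apply hm.aemeasurable A)

lemma mahalSq_sub_posteriorMean (hS : S.PosDef) (h : IsLocalPrior a K ℓ) (hτ : 0 < τ)
    (θ₀ x : Vec k) :
    mahalSq S (θ₀ - posteriorMean S a K ℓ τ x) =
      ‖whiten S θ₀ - shrinkMean k a K ℓ τ (‖whiten S x‖ ^ 2) • whiten S x‖ ^ 2 := by
  rw [mahalSq_eq hS, posteriorMean_eq hS h hτ, map_sub, map_smul]

lemma whiten_add (hS : S.PosDef) (θ₀ z : Vec k) :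
    whiten S (θ₀ + sqrtCLM S z) = whiten S θ₀ + z := by rw [map_add, whiten_sqrtCLM hS]

end GlobalLocal

end

/-! ### Tails of the scale prior, and the posterior scale for small and moderate t. -/

noncomputable section

namespace GlobalLocal

variable {k : ℕ} {a K τ t : ℝ} {ℓ : ℝ → ℝ}

/-- Measurability of `ℓ` is not a hypothesis; it comes from monotonicity. -/
lemma aemeasurable_localDensity (h : IsLocalPrior a K ℓ) :
    AEMeasurable (fun u => ENNReal.ofReal (K * u ^ (-a - 1) * ℓ u))
      (volume.restrict (Set.Ioi (0 : ℝ))) := by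
  have := aemeasurable_restrict_of_monotoneOn (μ := volume) measurableSet_Ioi h.mono
  exact (AEMeasurable.mul (by fun_prop) this).ennreal_ofReal

lemma localLaw_restrict_Ioi (h : IsLocalPrior a K ℓ) {c : ℝ} (hc : 0 < c) {g : ℝ → ENNReal}
    (hg : Measurable g) {M : ℝ} (hM : ∀ u, 0 < u → ℓ u ≤ M) :
    ∫⁻ u in Set.Ioi c, g u ∂(localLaw a K ℓ) ≤
      ∫⁻ u in Set.Ioi c, ENNReal.ofReal (K * M * u ^ (-a - 1)) * g u := by
  rw [localLaw, restrict_withDensity measurableSet_Ioi, Measure.restrict_restrict measurableSet_Ioi,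
    Set.inter_eq_left.2 (Set.Ioi_subset_Ioi hc.le),
    lintegral_withDensity_eq_lintegral_mul₀
      ((aemeasurable_localDensity h).mono_measure
        (Measure.restrict_mono (Set.Ioi_subset_Ioi hc.le) le_rfl)) hg.aemeasurable]
  refine setLIntegral_mono (by fun_prop) fun u hu => ?_
  have hu0 : 0 < u := hc.trans hu
  refine mul_le_mul' (ENNReal.ofReal_le_ofReal ?_) le_rfl
  have h1 : 0 ≤ K * u ^ (-a - 1) := by have := h.K_pos; positivity
  calc K * u ^ (-a - 1) * ℓ u ≤ K * u ^ (-a - 1) * M := mul_le_mul_of_nonneg_left (hM u hu0) h1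
    _ = _ := by ring

/-- On (0, 1] the power is at most one, and beyond 1 the tail exponent b - a - 1 is below -1. -/
lemma lintegral_rpow_localLaw_ne_top (h : IsLocalPrior a K ℓ) {b : ℝ} (hb : 0 < b) (hba : b < a) :
    ∫⁻ u, ENNReal.ofReal (u ^ b) ∂(localLaw a K ℓ) ≠ ⊤ := by
  have := isProbabilityMeasure_localLaw h
  obtain ⟨M, hM⟩ := h.bddAbove
  have hbound : ∫⁻ u, ENNReal.ofReal (u ^ b) ∂(localLaw a K ℓ) ≤
      ∫⁻ u, (1 + (Set.Ioi (1 : ℝ)).indicator (fun u => ENNReal.ofReal (u ^ b)) u)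
        ∂(localLaw a K ℓ) := by
    refine lintegral_mono_ae ?_
    filter_upwards [ae_localLaw_pos a K ℓ] with u hu
    by_cases h1 : u ∈ Set.Ioi (1 : ℝ)
    · rw [Set.indicator_of_mem h1]; exact le_add_self
    · rw [Set.indicator_of_notMem h1, add_zero]
      exact ENNReal.ofReal_le_one.2 (Real.rpow_le_one hu.le (not_lt.1 h1) hb.le)
  refine ne_top_of_le_ne_top ?_ hbound
  rw [lintegral_add_left measurable_const, lintegral_const, measure_univ, mul_one,
    lintegral_indicator measurableSet_Ioi]
  refine ENNReal.add_ne_top.2 ⟨ENNReal.one_ne_top, ne_top_of_le_ne_top ?_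
    (localLaw_restrict_Ioi h one_pos (by fun_prop) hM)⟩
  have hint : IntegrableOn (fun u : ℝ => K * M * u ^ (b - a - 1)) (Set.Ioi 1) :=
    (integrableOn_Ioi_rpow_of_lt (by linarith) one_pos).const_mul _
  refine ne_top_of_le_ne_top hint.lintegral_lt_top.ne
    (setLIntegral_mono (by fun_prop) fun u hu => ?_)
  have hu0 : (0 : ℝ) < u := one_pos.trans hu
  rw [← ENNReal.ofReal_mul' (by positivity), mul_assoc, ← Real.rpow_add hu0]
  exact le_of_eq (by congr 3; ring)

lemma localLaw_Ioi_le (h : IsLocalPrior a K ℓ) {M : ℝ} (hM : ∀ u, 0 < u → ℓ u ≤ M) {c : ℝ}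
    (hc : 0 < c) : localLaw a K ℓ (Set.Ioi c) ≤ ENNReal.ofReal (K * M / a * c ^ (-a)) := by
  have h1 := localLaw_restrict_Ioi h hc (g := fun _ => 1) measurable_const hM
  simp only [mul_one, setLIntegral_one] at h1
  refine h1.trans_eq ?_
  have ha := h.a_pos
  have hM0 : 0 ≤ M := (h.nonneg 1 one_pos).trans (hM 1 one_pos)
  have hint : IntegrableOn (fun u : ℝ => K * M * u ^ (-a - 1)) (Set.Ioi c) :=
    (integrableOn_Ioi_rpow_of_lt (by linarith) hc).const_mul _
  rw [← ofReal_integral_eq_lintegral_ofReal hint, integral_const_mul,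
    integral_Ioi_rpow_of_lt (by linarith) hc]
  · congr 1
    rw [show -a - 1 + 1 = -a by ring]
    field_simp
  · filter_upwards [ae_restrict_mem measurableSet_Ioi] with u hu
    have hu0 : 0 < u := hc.trans hu
    have := h.K_pos
    simp only [Pi.zero_apply]
    positivity

lemma le_localLaw_Ioc (h : IsLocalPrior a K ℓ) {m u₀ : ℝ} (hm : ∀ u, u₀ ≤ u → m ≤ ℓ u)
    {c : ℝ} (hc : 0 < c) (hu₀ : u₀ ≤ c) (hm0 : 0 ≤ m) :
    ENNReal.ofReal (K * (2 * c) ^ (-a - 1) * m * c) ≤ localLaw a K ℓ (Set.Ioc c (2 * c)) := by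
  have hsub : Set.Ioc c (2 * c) ⊆ Set.Ioi 0 := fun u hu => hc.trans hu.1
  have hK := h.K_pos
  have ha := h.a_pos
  rw [localLaw, withDensity_apply _ measurableSet_Ioc, Measure.restrict_restrict measurableSet_Ioc,
    Set.inter_eq_left.2 hsub]
  calc ENNReal.ofReal (K * (2 * c) ^ (-a - 1) * m * c)
      = ∫⁻ _ in Set.Ioc c (2 * c), ENNReal.ofReal (K * (2 * c) ^ (-a - 1) * m) := by
        rw [setLIntegral_const, Real.volume_Ioc, ← ENNReal.ofReal_mul (by positivity)]
        congr 2; ring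
    _ ≤ _ := by
        refine setLIntegral_mono_ae ((aemeasurable_localDensity h).mono_measure
          (Measure.restrict_mono hsub le_rfl)) (ae_of_all _ fun u hu => ?_)
        have hu0 : 0 < u := hsub hu
        refine ENNReal.ofReal_le_ofReal ?_
        have h1 : (2 * c) ^ (-a - 1) ≤ u ^ (-a - 1) :=
          Real.rpow_le_rpow_of_nonpos hu0 hu.2 (by linarith)
        have h2 : m ≤ ℓ u := hm u (hu₀.trans hu.1.le)
        gcongr

lemma tendsto_localLaw_Iio (h : IsLocalPrior a K ℓ) :
    Tendsto (fun u => (localLaw a K ℓ).real (Set.Iio u)) (𝓝[>] 0) (𝓝 0) := by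
  have := isProbabilityMeasure_localLaw h
  have h1 := tendsto_measure_biInter_gt (μ := localLaw a K ℓ) (a := (0 : ℝ))
    (s := fun u : ℝ => Set.Iio u) (fun _ _ => measurableSet_Iio.nullMeasurableSet)
    (fun _ _ _ hij => Set.Iio_subset_Iio hij) ⟨1, one_pos, measure_ne_top _ _⟩
  have h2 : localLaw a K ℓ (⋂ u : ℝ, ⋂ (_ : u > 0), Set.Iio u) = 0 := by
    refine measure_mono_null (fun u hu => ?_) (ae_localLaw_pos a K ℓ)
    simp only [Set.mem_iInter, Set.mem_Iio] at hu
    exact fun hu0 : 0 < u => lt_irrefl _ (hu u hu0)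
  rw [h2] at h1
  exact (ENNReal.tendsto_toReal ENNReal.zero_ne_top).comp h1

lemma lintegral_postScale_le {g : ℝ → ENNReal} (hg : Measurable g)
    {A E : ℝ} (hE : 0 < E) (hev : ENNReal.ofReal E ≤ evidence k a K ℓ τ t)
    (hA : ∫⁻ u, ENNReal.ofReal (marginal k t (u * τ)) * g u ∂(localLaw a K ℓ) ≤
      ENNReal.ofReal A) :
    ∫⁻ u, g u ∂(postScale k a K ℓ τ t) ≤ ENNReal.ofReal (A / E) := by
  rw [postScale, lintegral_smul_measure,
    lintegral_withDensity_eq_lintegral_mul _ (measurable_marginal t τ).ennreal_ofReal hg,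
    ENNReal.ofReal_div_of_pos hE, smul_eq_mul, mul_comm, ENNReal.div_eq_inv_mul, mul_comm]
  exact mul_le_mul' (ENNReal.inv_le_inv.2 hev) hA

/-- A lower bound for the evidence per unit of `exp (-t/2)`, uniform in `τ ≤ 1`. -/
def evidenceConst (k : ℕ) (a K : ℝ) (ℓ : ℝ → ℝ) : ℝ := (evidence k a K ℓ 1 0).toReal

lemma evidenceConst_pos (h : IsLocalPrior a K ℓ) : 0 < evidenceConst k a K ℓ :=
  ENNReal.toReal_pos (evidence_ne_zero h one_pos) (evidence_ne_top h one_pos le_rfl)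

/-- Pointwise in u: the exponent is smallest at κ = 0, and the power factor decreases in τ, so τ = 1
is the worst case. -/
lemma exp_mul_evidenceConst_le (h : IsLocalPrior a K ℓ) (hτ : 0 < τ) (hτ1 : τ ≤ 1) (ht : 0 ≤ t) :
    ENNReal.ofReal (Real.exp (-t / 2) * evidenceConst k a K ℓ) ≤ evidence k a K ℓ τ t := by
  rw [ENNReal.ofReal_mul (Real.exp_pos _).le, evidenceConst,
    ENNReal.ofReal_toReal (evidence_ne_top h one_pos le_rfl), evidence, evidence,
    ← lintegral_const_mul _ (measurable_marginal 0 1).ennreal_ofReal]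
  refine lintegral_mono_ae ?_
  filter_upwards [ae_localLaw_pos a K ℓ] with u hu
  rw [← ENNReal.ofReal_mul (Real.exp_pos _).le]
  refine ENNReal.ofReal_le_ofReal ?_
  have hκ : 0 < u * τ := by positivity
  have hle : u * τ ≤ u * 1 := by gcongr
  unfold marginal
  rw [zero_div, neg_zero, Real.exp_zero, mul_one, mul_comm]
  refine mul_le_mul ?_ (Real.exp_le_exp.2 ?_) (by positivity) (by positivity)
  · gcongr
  · rw [neg_div, neg_le_neg_iff]
    exact div_le_div_of_nonneg_left ht two_pos (by linarith)

lemma ofReal_shrinkMean (h : IsLocalPrior a K ℓ) (hτ : 0 < τ) (ht : 0 ≤ t) :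
    ENNReal.ofReal (shrinkMean k a K ℓ τ t) =
      ∫⁻ u, ENNReal.ofReal (shrink (u * τ)) ∂(postScale k a K ℓ τ t) := by
  refine ofReal_integral_eq_lintegral_ofReal (integrable_shrink h hτ ht) ?_
  filter_upwards [ae_postScale_pos k a K ℓ τ t] with u hu
  exact (shrink_pos (by positivity)).le

/-- The left side is at most min(κ, 1), between which and κ^b lies no gap. A power b < a is needed
later because the prior has guaranteed moments only below order a. -/
lemma shrink_le_rpow {κ b : ℝ} (hκ : 0 < κ) (hb : 0 < b) (hb1 : b ≤ 1) : shrink κ ≤ κ ^ b := by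
  rcases le_total κ 1 with h1 | h1
  · calc shrink κ ≤ κ := div_le_self hκ.le (by linarith)
      _ = κ ^ (1 : ℝ) := (Real.rpow_one κ).symm
      _ ≤ κ ^ b := Real.rpow_le_rpow_of_exponent_ge hκ h1 hb1
  · exact (shrink_lt_one hκ).le.trans (Real.one_le_rpow h1 hb.le)

/-- The posterior mean of the shrinkage factor is polynomially small in `τ` as long as `exp (t/2)`
is not too large. -/
lemma exists_shrinkMean_le (k : ℕ) (h : IsLocalPrior a K ℓ) {b : ℝ} (hb : 0 < b) (hba : b < a)
    (hb1 : b ≤ 1) : ∃ C : ℝ, 0 < C ∧ ∀ τ t : ℝ, 0 < τ → τ ≤ 1 → 0 ≤ t →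
      shrinkMean k a K ℓ τ t ≤ C * τ ^ b * Real.exp (t / 2) := by
  set M := (∫⁻ u, ENNReal.ofReal (u ^ b) ∂(localLaw a K ℓ)).toReal with hM
  have hc := evidenceConst_pos (k := k) h
  have hM0 : 0 ≤ M := ENNReal.toReal_nonneg
  refine ⟨(M + 1) / evidenceConst k a K ℓ, by positivity, fun τ t hτ hτ1 ht => ?_⟩
  have key := lintegral_postScale_le (k := k) (measurable_shrink τ).ennreal_ofReal
    (A := M * τ ^ b) (mul_pos (Real.exp_pos (-t / 2)) hc) (exp_mul_evidenceConst_le h hτ hτ1 ht) (by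
      rw [ENNReal.ofReal_mul hM0, hM, ENNReal.ofReal_toReal
        (lintegral_rpow_localLaw_ne_top h hb hba), ← lintegral_mul_const _ (by fun_prop)]
      refine lintegral_mono_ae ?_
      filter_upwards [ae_localLaw_pos a K ℓ] with u hu
      have hκ : 0 < u * τ := by positivity
      refine (mul_le_of_le_one_left' (ENNReal.ofReal_le_one.2 (marginal_le_one hκ.le ht))).trans ?_
      rw [← ENNReal.ofReal_mul (by positivity), ← Real.mul_rpow hu.le hτ.le]
      exact ENNReal.ofReal_le_ofReal (shrink_le_rpow hκ hb hb1))
  rw [← ofReal_shrinkMean h hτ ht, ENNReal.ofReal_le_ofReal_iff (by positivity)] at key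
  refine key.trans ?_
  rw [neg_div, Real.exp_neg]
  have : M * τ ^ b / ((Real.exp (t / 2))⁻¹ * evidenceConst k a K ℓ) =
    M / evidenceConst k a K ℓ * τ ^ b * Real.exp (t / 2) := by field_simp
  rw [this]
  gcongr
  linarith

lemma postScale_real_le {B : Set ℝ} (hB : MeasurableSet B)
    {A E : ℝ} (hA0 : 0 ≤ A) (hE : 0 < E) (hev : ENNReal.ofReal E ≤ evidence k a K ℓ τ t)
    (hA : ∫⁻ u, ENNReal.ofReal (marginal k t (u * τ)) * B.indicator 1 u ∂(localLaw a K ℓ) ≤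
      ENNReal.ofReal A) :
    (postScale k a K ℓ τ t).real B ≤ A / E := by
  have := lintegral_postScale_le (measurable_one.indicator hB) hE hev hA
  rw [lintegral_indicator_one hB] at this
  exact ENNReal.toReal_le_of_le_ofReal (by positivity) this

/-- For bounded `t` the posterior puts little mass on shrinkage factors far below `τ`. -/
lemma exists_postScale_small_le (k : ℕ) (h : IsLocalPrior a K ℓ) (T : ℝ) {ε : ℝ} (hε : 0 < ε) :
    ∃ c : ℝ, 0 < c ∧ ∀ τ t : ℝ, 0 < τ → τ ≤ 1 → 0 ≤ t → t ≤ T →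
      (postScale k a K ℓ τ t).real {u | shrink (u * τ) < c * τ} ≤ ε := by
  have := isProbabilityMeasure_localLaw h
  have hc := evidenceConst_pos (k := k) h
  have hE : 0 < Real.exp (-T / 2) * evidenceConst k a K ℓ := by positivity
  obtain ⟨v, hv, hv0⟩ := (((tendsto_localLaw_Iio h).eventually_lt_const
    (show 0 < ε * (Real.exp (-T / 2) * evidenceConst k a K ℓ) by positivity)).and
    self_mem_nhdsWithin).exists
  have hv0 : 0 < v := hv0
  -- If u ≥ v and τ ≤ 1, then uτ/(1+uτ) ≥ vτ/(1+v). The bad event therefore lies in u < v, whose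
  -- prior mass is at most ε times the evidence bound at the worst value t = T.
  refine ⟨v / (1 + v), by positivity, fun τ t hτ hτ1 ht htT => ?_⟩
  refine (postScale_real_le (measurableSet_lt (measurable_shrink τ) measurable_const)
    (A := (localLaw a K ℓ).real (Set.Iio v)) measureReal_nonneg hE
    ((ENNReal.ofReal_le_ofReal ?_).trans (exp_mul_evidenceConst_le h hτ hτ1 ht)) ?_).trans ?_
  · gcongr
  · rw [ofReal_measureReal, ← lintegral_indicator_one measurableSet_Iio]
    refine lintegral_mono_ae ?_
    filter_upwards [ae_localLaw_pos a K ℓ] with u hu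
    have hκ : 0 < u * τ := by positivity
    refine (mul_le_of_le_one_left' (ENNReal.ofReal_le_one.2 (marginal_le_one hκ.le ht))).trans ?_
    refine Set.indicator_le_indicator_of_subset (fun w hw => ?_) (fun _ => zero_le) u
    by_contra hwv
    have hwv : v ≤ w := not_lt.1 hwv
    have hw0 : 0 < w := hv0.trans_le hwv
    have hw : w * τ / (1 + w * τ) < v / (1 + v) * τ := hw
    rw [div_mul_eq_mul_div, div_lt_div_iff₀ (by positivity) (by positivity)] at hw
    have h1 : v * τ * (w * τ) ≤ v * τ * w := by
      refine mul_le_mul_of_nonneg_left ?_ (by positivity)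
      exact mul_le_of_le_one_right hw0.le hτ1
    have h2 : v * τ ≤ w * τ := by gcongr
    nlinarith
  · rw [div_le_iff₀ hE]
    exact hv.le

end GlobalLocal

end

/-! ### Large t: the shrinkage factor concentrates near one. -/

noncomputable section

namespace GlobalLocal

variable {k : ℕ} {a K τ t : ℝ} {ℓ : ℝ → ℝ}

/-- Only the scales with t < uτ ≤ 2t are kept. There the exponential is at least exp(-1/2), the
power factor is at least (3t)^(-k), and the prior mass is of order (τ/t)^a. The crude powers of t
are harmless against later exponentials. -/
lemma le_evidence_of_large (k : ℕ) (h : IsLocalPrior a K ℓ) :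
    ∃ c T : ℝ, 0 < c ∧ 1 ≤ T ∧ ∀ τ t : ℝ, 0 < τ → τ < 1 → T ≤ t →
      ENNReal.ofReal (c * (t ^ a * t ^ k)⁻¹ * τ ^ a) ≤ evidence k a K ℓ τ t := by
  obtain ⟨u₀, m, hu₀, hm, hℓ⟩ := h.bddBelow
  have hK := h.K_pos
  refine ⟨K * 2 ^ (-a - 1) * m * (3⁻¹ ^ k * Real.exp (-(1 / 2))), max 1 u₀, by positivity,
    le_max_left _ _, fun τ t hτ hτ1 ht => ?_⟩
  have ht1 : 1 ≤ t := (le_max_left _ _).trans ht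
  have ht0 : 0 < t := by linarith
  have hut : u₀ ≤ t / τ := by
    rw [le_div_iff₀ hτ]
    have : u₀ ≤ t := (le_max_right _ _).trans ht
    nlinarith
  have hmass := le_localLaw_Ioc h hℓ (c := t / τ) (by positivity) hut hm.le
  calc ENNReal.ofReal (K * 2 ^ (-a - 1) * m * (3⁻¹ ^ k * Real.exp (-(1 / 2))) *
        (t ^ a * t ^ k)⁻¹ * τ ^ a)
      = ENNReal.ofReal ((3 * t)⁻¹ ^ k * Real.exp (-(1 / 2))) *
          ENNReal.ofReal (K * (2 * (t / τ)) ^ (-a - 1) * m * (t / τ)) := by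
        rw [← ENNReal.ofReal_mul (by positivity)]
        congr 1
        have e1 : (2 * (t / τ)) ^ (-a - 1) * (t / τ) = 2 ^ (-a - 1) * ((t ^ a)⁻¹ * τ ^ a) := by
          rw [Real.mul_rpow (by norm_num) (by positivity), mul_assoc,
            Real.rpow_sub_one (x := t / τ) (by positivity), div_mul_cancel₀ _ (by positivity),
            Real.rpow_neg (by positivity), Real.div_rpow ht0.le hτ.le, inv_div, div_eq_inv_mul]
        calc _ = K * m * 3⁻¹ ^ k * (t ^ k)⁻¹ * Real.exp (-(1 / 2)) *
              (2 ^ (-a - 1) * ((t ^ a)⁻¹ * τ ^ a)) := by rw [mul_inv]; ring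
          _ = _ := by rw [← e1, mul_inv, mul_pow, inv_pow t]; ring
    _ ≤ ENNReal.ofReal ((3 * t)⁻¹ ^ k * Real.exp (-(1 / 2))) *
          localLaw a K ℓ (Set.Ioc (t / τ) (2 * (t / τ))) := by gcongr
    _ = ∫⁻ _ in Set.Ioc (t / τ) (2 * (t / τ)),
          ENNReal.ofReal ((3 * t)⁻¹ ^ k * Real.exp (-(1 / 2))) ∂(localLaw a K ℓ) := by
        rw [setLIntegral_const]
    _ ≤ ∫⁻ u in Set.Ioc (t / τ) (2 * (t / τ)),
          ENNReal.ofReal (marginal k t (u * τ)) ∂(localLaw a K ℓ) := by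
        refine setLIntegral_mono (measurable_marginal t τ).ennreal_ofReal fun u hu => ?_
        have h1 : t < u * τ := (div_lt_iff₀ hτ).1 hu.1
        have h2 : u * τ ≤ 2 * t := by
          have := mul_le_mul_of_nonneg_right hu.2 hτ.le
          rwa [mul_assoc, div_mul_cancel₀ _ hτ.ne'] at this
        have h0 : 0 < u * τ := ht0.trans h1
        refine ENNReal.ofReal_le_ofReal (mul_le_mul ?_ (Real.exp_le_exp.2 ?_) (by positivity)
          (by positivity))
        · refine pow_le_pow_left₀ (by positivity) (inv_anti₀ (by positivity) ?_) k
          exact (Real.sqrt_le_iff.2 ⟨by positivity, by nlinarith⟩)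
        · rw [neg_le_neg_iff, div_le_div_iff₀ (by positivity) (by norm_num)]
          linarith
    _ ≤ _ := setLIntegral_le_lintegral _ _

lemma one_div_rpow_le_exp {K' : ℝ} (hK' : 0 < K') (ha : 0 < a) (hτ : 0 < τ)
    (ht : K' * Real.log (1 / τ) ≤ t) : (τ ^ a)⁻¹ ≤ Real.exp (a / K' * t) := by
  rw [Real.rpow_def_of_pos hτ, ← Real.exp_neg, Real.exp_le_exp]
  rw [one_div, Real.log_inv] at ht
  calc -(Real.log τ * a) = a / K' * (K' * -Real.log τ) := by field_simp
    _ ≤ _ := by gcongr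

/-- Scales with κ ≤ κ₀ have likelihood at most exp(-qt), where q > a/K' pays for the factor τ^(-a) ≤
exp(at/K') lost on dividing by the evidence. Scales with κ > κ₀ have prior mass O(τ^a), which
cancels that factor, and on them s < 1 - δ forces likelihood at most exp(-δt/2). -/
lemma exists_postScale_large_le (k : ℕ) (h : IsLocalPrior a K ℓ) {K' : ℝ} (hK' : 2 * a < K') :
    ∃ C c T : ℝ, 0 < C ∧ 0 < c ∧ 1 ≤ T ∧ ∀ τ t δ : ℝ, 0 < τ → τ < 1 → T ≤ t →
      K' * Real.log (1 / τ) ≤ t →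
      (postScale k a K ℓ τ t).real {u | shrink (u * τ) < 1 - δ} ≤
        C * (t ^ a * t ^ k) * (Real.exp (-c * t) + Real.exp (-(1 / 2) * (δ * t))) := by
  obtain ⟨c₁, T, hc₁, hT, hev⟩ := le_evidence_of_large k h
  obtain ⟨M, hM⟩ := h.bddAbove
  have hM0 : 0 ≤ M := (h.nonneg 1 one_pos).trans (hM 1 one_pos)
  have ha := h.a_pos
  have hK := h.K_pos
  have hK0 : 0 < K' := by linarith
  have hq0 : a / K' < 1 / 2 := by rw [div_lt_div_iff₀ hK0 two_pos]; linarith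
  have haK : 0 < a / K' := by positivity
  -- q is the midpoint of a/K' and 1/2, and κ₀ > 0 solves 1/(2(1+κ₀)) = q.
  set q := (a / K' + 1 / 2) / 2 with hq
  set κ₀ := 1 / (2 * q) - 1 with hκ₀
  have hκ0 : 0 < κ₀ := by
    rw [hκ₀, sub_pos, lt_div_iff₀ (by positivity)]; linarith
  have hκq : 1 / (2 * (1 + κ₀)) = q := by
    rw [hκ₀, add_sub_cancel, mul_one_div, ← div_div, div_self two_ne_zero, one_div_one_div]
  set C₂ := K * M / a * κ₀ ^ (-a) with hC₂
  have hC₂0 : 0 ≤ C₂ := by positivity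
  refine ⟨(1 + C₂) / c₁, q - a / K', T, by positivity, by linarith, hT,
    fun τ t δ hτ hτ1 hTt hKt => ?_⟩
  have ht0 : 0 < t := by linarith
  have hP : 0 < t ^ a * t ^ k := by positivity
  refine (postScale_real_le (measurableSet_lt (measurable_shrink τ) measurable_const)
    (A := Real.exp (-q * t) + Real.exp (-(1 / 2) * (δ * t)) * (C₂ * τ ^ a)) (by positivity)
    (by positivity) (hev τ t hτ hτ1 hTt) ?_).trans ?_
  · have htail := localLaw_Ioi_le h hM (c := κ₀ / τ) (by positivity)
    have e1 : K * M / a * (κ₀ / τ) ^ (-a) = C₂ * τ ^ a := by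
      rw [Real.div_rpow hκ0.le hτ.le, Real.rpow_neg hτ.le a, div_inv_eq_mul, hC₂]; ring
    rw [e1] at htail
    have := isProbabilityMeasure_localLaw h
    calc _ ≤ ∫⁻ u, (ENNReal.ofReal (Real.exp (-q * t)) +
          ENNReal.ofReal (Real.exp (-(1 / 2) * (δ * t))) * (Set.Ioi (κ₀ / τ)).indicator 1 u)
            ∂(localLaw a K ℓ) := by
          refine lintegral_mono_ae ?_
          filter_upwards [ae_localLaw_pos a K ℓ] with u hu
          have hκ : 0 < u * τ := by positivity
          by_cases hs : u ∈ {u | shrink (u * τ) < 1 - δ}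
          swap
          · rw [Set.indicator_of_notMem hs, mul_zero]; exact zero_le
          rw [Set.indicator_of_mem hs, Pi.one_apply, mul_one]
          have hmarg : marginal k t (u * τ) ≤ Real.exp (-(t / (2 * (1 + u * τ)))) := by
            refine mul_le_of_le_one_left (Real.exp_pos _).le (pow_le_one₀ (by positivity) ?_)
            exact inv_le_one_of_one_le₀ (Real.one_le_sqrt.2 (by linarith))
          by_cases hu' : u ∈ Set.Ioi (κ₀ / τ)
          · rw [Set.indicator_of_mem hu', Pi.one_apply, mul_one]
            refine le_add_left (ENNReal.ofReal_le_ofReal (hmarg.trans (Real.exp_le_exp.2 ?_)))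
            have hs' : shrink (u * τ) < 1 - δ := hs
            have h2 : δ < (1 + u * τ)⁻¹ := by rw [← one_sub_shrink hκ]; linarith
            have h3 : δ * t ≤ (1 + u * τ)⁻¹ * t := by gcongr
            have h4 : t / (2 * (1 + u * τ)) = 1 / 2 * ((1 + u * τ)⁻¹ * t) := by field_simp
            rw [h4]; linarith
          · rw [Set.indicator_of_notMem hu', mul_zero, add_zero]
            refine ENNReal.ofReal_le_ofReal (hmarg.trans (Real.exp_le_exp.2 ?_))
            have h2 : u * τ ≤ κ₀ := (le_div_iff₀ hτ).1 (not_lt.1 hu')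
            rw [neg_mul, neg_le_neg_iff, ← hκq, one_div, ← div_eq_inv_mul]
            gcongr
      _ = ENNReal.ofReal (Real.exp (-q * t)) + ENNReal.ofReal (Real.exp (-(1 / 2) * (δ * t))) *
            localLaw a K ℓ (Set.Ioi (κ₀ / τ)) := by
          rw [lintegral_add_left measurable_const, lintegral_const, measure_univ, mul_one,
            lintegral_const_mul _ (measurable_one.indicator measurableSet_Ioi),
            lintegral_indicator_one measurableSet_Ioi]
      _ ≤ ENNReal.ofReal (Real.exp (-q * t)) + ENNReal.ofReal (Real.exp (-(1 / 2) * (δ * t))) *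
            ENNReal.ofReal (C₂ * τ ^ a) := by gcongr
      _ = _ := by
          rw [← ENNReal.ofReal_mul (by positivity), ← ENNReal.ofReal_add (by positivity)
            (by positivity)]
  · have h1 := one_div_rpow_le_exp (a := a) hK0 ha hτ hKt
    have e2 : (Real.exp (-q * t) + Real.exp (-(1 / 2) * (δ * t)) * (C₂ * τ ^ a)) /
        (c₁ * (t ^ a * t ^ k)⁻¹ * τ ^ a) = (t ^ a * t ^ k) / c₁ *
          (Real.exp (-q * t) * (τ ^ a)⁻¹ + C₂ * Real.exp (-(1 / 2) * (δ * t))) := by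
      field_simp
    have h2 : Real.exp (-q * t) * (τ ^ a)⁻¹ ≤ Real.exp (-(q - a / K') * t) := by
      calc _ ≤ Real.exp (-q * t) * Real.exp (a / K' * t) := by gcongr
        _ = _ := by rw [← Real.exp_add]; congr 1; ring
    rw [e2]
    have h3 : 0 < Real.exp (-(q - a / K') * t) := Real.exp_pos _
    have h4 : 0 < Real.exp (-(1 / 2) * (δ * t)) := Real.exp_pos _
    calc _ ≤ (t ^ a * t ^ k) / c₁ * ((1 + C₂) * (Real.exp (-(q - a / K') * t) +
          Real.exp (-(1 / 2) * (δ * t)))) := by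
          gcongr
          nlinarith [mul_nonneg hC₂0 h3.le]
      _ = _ := by ring

lemma one_sub_shrinkMean_le (h : IsLocalPrior a K ℓ) (hτ : 0 < τ) (ht : 0 ≤ t) {δ : ℝ}
    (hδ : 0 ≤ δ) :
    1 - shrinkMean k a K ℓ τ t ≤ δ + (postScale k a K ℓ τ t).real {u | shrink (u * τ) < 1 - δ} := by
  have := isProbabilityMeasure_postScale (k := k) h hτ ht
  have hint := integrable_shrink (k := k) h hτ ht
  have hB : MeasurableSet {u | shrink (u * τ) < 1 - δ} :=
    measurableSet_lt (measurable_shrink τ) measurable_const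
  have hi : Integrable ({u | shrink (u * τ) < 1 - δ}.indicator (1 : ℝ → ℝ))
      (postScale k a K ℓ τ t) := (integrable_const (1 : ℝ)).indicator hB
  have e : 1 - shrinkMean k a K ℓ τ t = ∫ u, (1 - shrink (u * τ)) ∂(postScale k a K ℓ τ t) := by
    rw [integral_sub (integrable_const 1) hint]; simp [shrinkMean]
  have e' : δ + (postScale k a K ℓ τ t).real {u | shrink (u * τ) < 1 - δ} =
      ∫ u, (δ + {u | shrink (u * τ) < 1 - δ}.indicator (1 : ℝ → ℝ) u)
        ∂(postScale k a K ℓ τ t) := by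
    rw [integral_add (integrable_const δ) hi, integral_indicator_one hB]; simp
  rw [e, e']
  refine integral_mono_ae ((integrable_const 1).sub hint) ((integrable_const δ).add hi) ?_
  filter_upwards [ae_postScale_pos k a K ℓ τ t] with u hu
  by_cases hs : u ∈ {u | shrink (u * τ) < 1 - δ}
  · rw [Set.indicator_of_mem hs]
    have := shrink_pos (κ := u * τ) (by positivity)
    simp only [Pi.one_apply]; linarith
  · rw [Set.indicator_of_notMem hs]
    have : 1 - δ ≤ shrink (u * τ) := not_lt.1 hs
    linarith

/-- The cut-off δ = t^(-3/4) satisfies √t δ → 0 while δt = t^(1/4) → ∞, so the exponential beats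
every power of t. -/
lemma tendsto_large_bound (k : ℕ) (a C : ℝ) {c : ℝ} (hc : 0 < c) :
    Tendsto (fun t : ℝ => √t * (t ^ (-(3 / 4) : ℝ) + C * (t ^ a * t ^ k) *
      (Real.exp (-c * t) + Real.exp (-(1 / 2) * (t ^ (-(3 / 4) : ℝ) * t))))) atTop (𝓝 0) := by
  set p : ℝ := 1 / 2 + a + k with hp
  have l1 : Tendsto (fun t : ℝ => t ^ (-(1 / 4) : ℝ)) atTop (𝓝 0) :=
    tendsto_rpow_neg_atTop (by norm_num)
  have l2 := tendsto_rpow_mul_exp_neg_mul_atTop_nhds_zero p c hc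
  have l3 := (tendsto_rpow_mul_exp_neg_mul_atTop_nhds_zero (4 * p) (1 / 2) (by norm_num)).comp
    (tendsto_rpow_atTop (y := 1 / 4) (by norm_num))
  have l := l1.add ((l2.add l3).const_mul C)
  simp only [add_zero, mul_zero] at l
  refine l.congr' ?_
  filter_upwards [eventually_gt_atTop 0] with t ht
  have e1 : √t * t ^ (-(3 / 4) : ℝ) = t ^ (-(1 / 4) : ℝ) := by
    rw [Real.sqrt_eq_rpow, ← Real.rpow_add ht]; norm_num
  have e2 : t ^ (-(3 / 4) : ℝ) * t = t ^ (1 / 4 : ℝ) := by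
    nth_rewrite 2 [← Real.rpow_one t]
    rw [← Real.rpow_add ht]; norm_num
  have e3 : (t ^ (1 / 4 : ℝ)) ^ (4 * p) = t ^ p := by
    rw [← Real.rpow_mul ht.le]; congr 1; ring
  have e4 : √t * (t ^ a * t ^ k) = t ^ p := by
    rw [Real.sqrt_eq_rpow, ← Real.rpow_natCast t k, ← Real.rpow_add ht, ← Real.rpow_add ht, hp,
      add_assoc]
  simp only [Function.comp_apply, e2, e3]
  rw [mul_add (√t), e1, ← e4]
  ring

/-- For `t` large, and larger than `2a log (1/τ)` by a factor, the posterior mean is close to the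
observation and the posterior concentrates on shrinkage factors close to one. -/
lemma exists_no_shrinkage (k : ℕ) (h : IsLocalPrior a K ℓ) {K' : ℝ} (hK' : 2 * a < K')
    {ε : ℝ} (hε : 0 < ε) :
    ∃ T : ℝ, ∀ τ t : ℝ, 0 < τ → τ < 1 → T ≤ t → K' * Real.log (1 / τ) ≤ t →
      √t * (1 - shrinkMean k a K ℓ τ t) ≤ ε ∧
      (postScale k a K ℓ τ t).real {u | shrink (u * τ) < 1 - ε} ≤ ε := by
  obtain ⟨C, c, T, hC, hc, hT, hb⟩ := exists_postScale_large_le k h hK'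
  obtain ⟨T', hT'⟩ := eventually_atTop.1 (((tendsto_large_bound k a C hc).eventually_lt_const hε).and
    (((tendsto_rpow_neg_atTop (y := 3 / 4) (by norm_num)).eventually_lt_const hε)))
  refine ⟨max T T', fun τ t hτ hτ1 ht hKt => ?_⟩
  have ht1 : 1 ≤ t := hT.trans ((le_max_left _ _).trans ht)
  have ht0 : 0 < t := by linarith
  obtain ⟨h1, h2⟩ := hT' t ((le_max_right _ _).trans ht)
  have hb' := hb τ t (t ^ (-(3 / 4) : ℝ)) hτ hτ1 ((le_max_left _ _).trans ht) hKt
  have hδ : 0 ≤ t ^ (-(3 / 4) : ℝ) := by positivity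
  have hmean := one_sub_shrinkMean_le (k := k) h hτ ht0.le hδ
  have hsq : 1 ≤ √t := Real.one_le_sqrt.2 ht1
  constructor
  · refine le_trans ?_ h1.le
    gcongr
    linarith
  · have := isProbabilityMeasure_postScale (k := k) h hτ ht0.le
    have hmono : (postScale k a K ℓ τ t).real {u | shrink (u * τ) < 1 - ε} ≤
        (postScale k a K ℓ τ t).real {u | shrink (u * τ) < 1 - t ^ (-(3 / 4) : ℝ)} :=
      by
      refine measureReal_mono fun u hu => ?_
      have hu : shrink (u * τ) < 1 - ε := hu
      change shrink (u * τ) < _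
      linarith
    -- Since √t ≥ 1, the expression bounded in `h1` dominates the mass bound alone.
    refine (hmono.trans hb').trans (le_trans ?_ h1.le)
    set G := C * (t ^ a * t ^ k) *
      (Real.exp (-c * t) + Real.exp (-(1 / 2) * (t ^ (-(3 / 4) : ℝ) * t))) with hG
    have hG0 : 0 ≤ G := by positivity
    nlinarith

end GlobalLocal

end

/-! ### The three regimes of means. -/

noncomputable section

namespace GlobalLocal

variable {k : ℕ} {S : Matrix (Fin k) (Fin k) ℝ} {a K : ℝ} {ℓ : ℝ → ℝ}

/-- A small weight costs only a factor near one on the main term, so bounded noise hardly changes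
the constant in front of log(1/τ). -/
lemma norm_add_sq_le_weighted {E : Type*} [SeminormedAddCommGroup E] (x z : E) {ε : ℝ}
    (hε : 0 < ε) : ‖x + z‖ ^ 2 ≤ (1 + ε) * ‖x‖ ^ 2 + (1 + 1 / ε) * ‖z‖ ^ 2 := by
  have h1 : ‖x + z‖ ^ 2 ≤ (‖x‖ + ‖z‖) ^ 2 := pow_le_pow_left₀ (norm_nonneg _) (norm_add_le x z) 2
  have h2 : (1 + ε) * ‖x‖ ^ 2 + (1 + 1 / ε) * ‖z‖ ^ 2 - (‖x‖ + ‖z‖) ^ 2 =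
      (ε * ‖x‖ - ‖z‖) ^ 2 / ε := by field_simp; ring
  have h3 : 0 ≤ (ε * ‖x‖ - ‖z‖) ^ 2 / ε := by positivity
  linarith

lemma tendsto_log_one_div : Tendsto (fun τ : ℝ => Real.log (1 / τ)) (𝓝[>] 0) atTop := by
  simp_rw [one_div]
  exact Real.tendsto_log_atTop.comp tendsto_inv_nhdsGT_zero

lemma tendsto_rpow_mul_log_one_div {s : ℝ} (hs : 0 < s) :
    Tendsto (fun τ : ℝ => τ ^ s * Real.log (1 / τ)) (𝓝[>] 0) (𝓝 0) := by
  have h := (tendsto_log_mul_rpow_nhdsGT_zero hs).neg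
  rw [neg_zero] at h
  refine h.congr fun τ => ?_
  rw [one_div, Real.log_inv]; ring

lemma tendsto_rpow_nhdsGT_zero {s : ℝ} (hs : 0 < s) :
    Tendsto (fun τ : ℝ => τ ^ s) (𝓝[>] 0) (𝓝 0) := by
  have h := (Real.continuousAt_rpow_const 0 s (Or.inr hs.le)).tendsto
  rw [Real.zero_rpow hs.ne'] at h
  exact h.mono_left nhdsWithin_le_nhds

lemma eventually_pos_lt_one : ∀ᶠ τ : ℝ in 𝓝[>] 0, 0 < τ ∧ τ < 1 :=
  Ioo_mem_nhdsGT one_pos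

lemma exists_le_normSqCdf (k : ℕ) {ε : ℝ} (hε : 0 < ε) : ∃ R : ℝ, 0 ≤ R ∧ 1 - ε ≤ normSqCdf k R :=
  ((eventually_ge_atTop 0).and (tendsto_normSqCdf_atTop.eventually_const_le (by linarith))).exists

/-- With e = a/(1+ρ), the squared error is O(τ) + O(τ^(2e)), which is o(τ^e) because 0 < e < a < 1;
the radius is at least qcτ, so the inflated threshold is at least of order τ^e. -/
lemma coverage_small_means (hk : 0 < k) (hS : S.PosDef) (h : IsLocalPrior a K ℓ) (ha1 : a < 1)
    {KS α ρ L : ℝ} (hKS : 0 < KS) (hα : 0 < α) (hα1 : α < 1) (hρ : 0 < ρ) (hL : 0 < L) :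
    ∀ᶠ τ in 𝓝[>] 0, ∀ θ₀ ∈ smallMeans S KS τ, 1 - α ≤ coverProb S a K ℓ α ρ L τ θ₀ := by
  have ha := h.a_pos
  set e := a / (1 + ρ) with he
  have he0 : 0 < e := by positivity
  have hea : e < a := div_lt_self ha (by linarith)
  obtain ⟨R, hR0, hR⟩ := exists_le_normSqCdf k hα
  set T := 2 * (KS + R) with hT
  have hT0 : 0 < T := by positivity
  -- Two errors of at most (1 - α)/4, one for small scales and one for the small ball, stay below 1
  -- - α together.
  obtain ⟨c, hc, hsmall⟩ := exists_postScale_small_le k h T (ε := (1 - α) / 4) (by linarith)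
  obtain ⟨q, hq, hq0⟩ := (((tendsto_normSqCdf_zero hk).eventually_lt_const
    (show 0 < (1 - α) / 4 by linarith)).and self_mem_nhdsWithin).exists
  have hq0 : 0 < q := hq0
  obtain ⟨C, hC, hmean⟩ := exists_shrinkMean_le k h he0 hea (by linarith)
  set C' := C * Real.exp (T / 2) with hC'
  have hlim : Tendsto (fun τ : ℝ => 2 * KS * τ ^ (1 - e) + 2 * C' ^ 2 * T * τ ^ e) (𝓝[>] 0)
      (𝓝 0) := by
    have := ((tendsto_rpow_nhdsGT_zero (s := 1 - e) (by linarith)).const_mul (2 * KS)).add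
      ((tendsto_rpow_nhdsGT_zero he0).const_mul (2 * C' ^ 2 * T))
    simpa using this
  filter_upwards [eventually_pos_lt_one, hlim.eventually_le_const
    (show 0 < L * (q * c) ^ e by positivity)] with τ ⟨hτ, hτ1⟩ hsm θ₀ hθ₀
  refine hR.trans (normSqCdf_le_real θ₀ _ fun z hz => ?_)
  set x := θ₀ + sqrtCLM S z with hx
  have hy : whiten S x = whiten S θ₀ + z := whiten_add hS θ₀ z
  have hη : ‖whiten S θ₀‖ ^ 2 ≤ KS * τ := by rw [← mahalSq_eq hS]; exact hθ₀
  set t := ‖whiten S x‖ ^ 2 with ht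
  have ht0 : 0 ≤ t := by positivity
  have htT : t ≤ T := by
    have := norm_add_sq_le_weighted (whiten S θ₀) z one_pos
    rw [← hy] at this
    have : KS * τ ≤ KS := mul_le_of_le_one_right hKS.le hτ1.le
    linarith
  have hr : q * c * τ ≤ credRadius S a K ℓ α τ x := by
    refine le_credRadius hS h hτ x hα (s₁ := c * τ) (by positivity) ?_
    have h1 := hsmall τ t hτ hτ1.le ht0 htT
    have h2 : q * c * τ / (c * τ) = q := by field_simp
    rw [h2]
    linarith
  have hm0 : 0 ≤ shrinkMean k a K ℓ τ t := shrinkMean_nonneg hτ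
  have hm : shrinkMean k a K ℓ τ t ≤ C' * τ ^ e := by
    refine (hmean τ t hτ hτ1.le ht0).trans ?_
    rw [hC', mul_right_comm]
    gcongr
  change mahalSq S (θ₀ - posteriorMean S a K ℓ τ x) ≤ L * credRadius S a K ℓ α τ x ^ e
  rw [mahalSq_sub_posteriorMean hS h hτ]
  have h1 : ‖whiten S θ₀ - shrinkMean k a K ℓ τ t • whiten S x‖ ^ 2 ≤
      2 * (KS * τ) + 2 * ((C' * τ ^ e) ^ 2 * T) := by
    have := norm_add_sq_le_weighted (whiten S θ₀) (-(shrinkMean k a K ℓ τ t • whiten S x)) one_pos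
    rw [← sub_eq_add_neg, norm_neg, norm_smul, mul_pow, Real.norm_eq_abs, sq_abs] at this
    have h2 : shrinkMean k a K ℓ τ t ^ 2 * t ≤ (C' * τ ^ e) ^ 2 * T := by gcongr
    linarith
  refine h1.trans ?_
  have hτe : τ = τ ^ (1 - e) * τ ^ e := by
    rw [← Real.rpow_add hτ]; simp
  calc 2 * (KS * τ) + 2 * ((C' * τ ^ e) ^ 2 * T)
      = (2 * KS * τ ^ (1 - e) + 2 * C' ^ 2 * T * τ ^ e) * τ ^ e := by
        nth_rewrite 1 [hτe]; ring
    _ ≤ L * (q * c) ^ e * τ ^ e := by gcongr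
    _ = L * (q * c * τ) ^ e := by rw [Real.mul_rpow (by positivity) hτ.le, mul_assoc]
    _ ≤ L * credRadius S a K ℓ α τ x ^ e := by gcongr

/-- Both the inflated radius and the norm of the posterior mean are bounded by positive powers of τ,
up to logarithms, hence are negligible against 1/log(1/τ). -/
lemma miss_medium_means (hS : S.PosDef) (h : IsLocalPrior a K ℓ) (ha1 : a < 1)
    {KM α ρ L ε : ℝ} (hKM : 0 < KM) (hKMa : KM < 2 * a) (hα : 0 < α) (hρ : 0 < ρ) (hL : 0 < L)
    (hε : 0 < ε) :
    ∀ᶠ τ in 𝓝[>] 0, ∀ θ₀, 1 / Real.log (1 / τ) ≤ mahalSq S θ₀ →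
      mahalSq S θ₀ ≤ KM * Real.log (1 / τ) → 1 - ε ≤ missProb S a K ℓ α ρ L τ θ₀ := by
  have ha := h.a_pos
  set e := a / (1 + ρ) with he
  have he0 : 0 < e := by positivity
  obtain ⟨R, hR0, hR⟩ := exists_le_normSqCdf k hε
  -- K' leaves room above `KM` for the noise, and b lies between K'/2 and a, so that τ^b exp(t/2) ≤
  -- τ^d with d > 0.
  set K' := (KM + 2 * a) / 2 with hK'
  set b := (K' / 2 + a) / 2 with hb
  set d := b - K' / 2 with hd
  have hd0 : 0 < d := by rw [hd, hb, hK']; linarith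
  have hde : 0 < d / 2 * e := by positivity
  obtain ⟨C, hC, hmean⟩ := exists_shrinkMean_le k h (b := b) (by rw [hb, hK']; linarith)
    (by rw [hb, hK']; linarith) (by rw [hb, hK']; linarith)
  set w := (K' - KM) / (2 * KM) with hw
  have hw0 : 0 < w := by
    have : KM < K' := by rw [hK']; linarith
    rw [hw]; apply div_pos <;> linarith
  have hwKM : (1 + w) * KM < K' := by
    rw [hw]
    have : (1 + (K' - KM) / (2 * KM)) * KM = (KM + K') / 2 := by field_simp; ring
    rw [this, hK']; linarith
  have hlim1 : Tendsto (fun τ : ℝ => C * (4 * K' * (τ ^ (d / 2) * Real.log (1 / τ)) +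
      2 * secondMoment k * τ ^ (d / 2))) (𝓝[>] 0) (𝓝 0) := by
    have := (((tendsto_rpow_mul_log_one_div (s := d / 2) (by positivity)).const_mul (4 * K')).add
      ((tendsto_rpow_nhdsGT_zero (s := d / 2) (by positivity)).const_mul
        (2 * secondMoment k))).const_mul C
    simpa using this
  have hlim2 : Tendsto (fun τ : ℝ => C * K' * (τ ^ (d / 2) * Real.log (1 / τ)) ^ 2 +
      L * (τ ^ (d / 2 * e) * Real.log (1 / τ))) (𝓝[>] 0) (𝓝 0) := by
    have := (((tendsto_rpow_mul_log_one_div (s := d / 2) (by positivity)).pow 2).const_mul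
      (C * K')).add ((tendsto_rpow_mul_log_one_div hde).const_mul L)
    simpa using this
  filter_upwards [eventually_pos_lt_one, hlim1.eventually_le_const hα,
    hlim2.eventually_lt_const (show (0 : ℝ) < 1 / 2 by norm_num),
    tendsto_log_one_div.eventually_ge_atTop ((1 + 1 / w) * R / (K' - (1 + w) * KM)),
    tendsto_log_one_div.eventually_gt_atTop 0] with τ ⟨hτ, hτ1⟩ h1 h2 h3 hΛ θ₀ hlo hhi
  set Λ := Real.log (1 / τ) with hΛdef
  refine hR.trans (normSqCdf_le_real θ₀ _ fun z hz => ?_)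
  set x := θ₀ + sqrtCLM S z with hx
  have hy : whiten S x = whiten S θ₀ + z := whiten_add hS θ₀ z
  rw [mahalSq_eq hS] at hlo hhi
  set t := ‖whiten S x‖ ^ 2 with ht
  have ht0 : 0 ≤ t := by positivity
  have htK : t ≤ K' * Λ := by
    have h5 := norm_add_sq_le_weighted (whiten S θ₀) z hw0
    rw [← hy] at h5
    rw [div_le_iff₀ (by linarith)] at h3
    have h6 : (1 + w) * ‖whiten S θ₀‖ ^ 2 ≤ (1 + w) * (KM * Λ) := by gcongr
    have h7 : (1 + 1 / w) * ‖z‖ ^ 2 ≤ (1 + 1 / w) * R := by gcongr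
    calc t ≤ _ := h5
      _ ≤ (1 + w) * (KM * Λ) + Λ * (K' - (1 + w) * KM) := by linarith
      _ = K' * Λ := by ring
  have hm0 : 0 ≤ shrinkMean k a K ℓ τ t := shrinkMean_nonneg hτ
  have hm1 : shrinkMean k a K ℓ τ t ≤ 1 := shrinkMean_le_one h hτ ht0
  have hm : shrinkMean k a K ℓ τ t ≤ C * τ ^ d := by
    refine (hmean τ t hτ hτ1.le ht0).trans ?_
    have h5 : Real.exp (t / 2) ≤ τ ^ (-(K' / 2)) := by
      rw [Real.rpow_def_of_pos hτ, Real.exp_le_exp]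
      have : Real.log τ = -Λ := by rw [hΛdef, one_div, Real.log_inv, neg_neg]
      rw [this]; linarith
    calc C * τ ^ b * Real.exp (t / 2) ≤ C * τ ^ b * τ ^ (-(K' / 2)) := by gcongr
      _ = C * τ ^ d := by rw [mul_assoc, ← Real.rpow_add hτ, hd]; rfl
  have hdd : τ ^ d = τ ^ (d / 2) * τ ^ (d / 2) := by rw [← Real.rpow_add hτ, add_halves]
  have hM0 := secondMoment_nonneg (k := k)
  -- Half of the exponent d is given up to absorb the logarithm and the constants.
  have hr : credRadius S a K ℓ α τ x ≤ τ ^ (d / 2) := by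
    refine credRadius_le hS h hτ x (by positivity) ?_
    calc shrinkMean k a K ℓ τ t * (4 * t + 2 * secondMoment k)
        ≤ C * τ ^ d * (4 * (K' * Λ) + 2 * secondMoment k) := by gcongr
      _ = C * (4 * K' * (τ ^ (d / 2) * Λ) + 2 * secondMoment k * τ ^ (d / 2)) * τ ^ (d / 2) := by
          rw [hdd]; ring
      _ ≤ α * τ ^ (d / 2) := by gcongr
  have hr0 := credRadius_nonneg (S := S) (a := a) (K := K) (ℓ := ℓ) (τ := τ) α x
  have hre : credRadius S a K ℓ α τ x ^ e ≤ τ ^ (d / 2 * e) := by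
    rw [Real.rpow_mul hτ.le]; gcongr
  change ¬ (mahalSq S (θ₀ - posteriorMean S a K ℓ τ x) ≤ L * credRadius S a K ℓ α τ x ^ e)
  rw [mahalSq_sub_posteriorMean hS h hτ, not_le]
  refine (mul_le_mul_of_nonneg_left hre hL.le).trans_lt ?_
  have h5 : ‖whiten S θ₀‖ ^ 2 ≤ 2 * ‖whiten S θ₀ - shrinkMean k a K ℓ τ t • whiten S x‖ ^ 2 +
      2 * (C * τ ^ d * (K' * Λ)) := by
    have := norm_add_sq_le_weighted (whiten S θ₀ - shrinkMean k a K ℓ τ t • whiten S x)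
      (shrinkMean k a K ℓ τ t • whiten S x) one_pos
    rw [sub_add_cancel, norm_smul, mul_pow, Real.norm_eq_abs, sq_abs] at this
    have h6 : shrinkMean k a K ℓ τ t ^ 2 ≤ C * τ ^ d :=
      (pow_le_of_le_one hm0 hm1 two_ne_zero).trans hm
    have h7 : shrinkMean k a K ℓ τ t ^ 2 * t ≤ C * τ ^ d * (K' * Λ) := by gcongr
    linarith
  have h8 : L * τ ^ (d / 2 * e) + C * τ ^ d * (K' * Λ) < 1 / Λ / 2 := by
    rw [div_div, lt_div_iff₀ (by positivity)]
    have : (L * τ ^ (d / 2 * e) + C * τ ^ d * (K' * Λ)) * (Λ * 2) =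
        2 * (C * K' * (τ ^ (d / 2) * Λ) ^ 2 + L * (τ ^ (d / 2 * e) * Λ)) := by rw [hdd]; ring
    linarith
  linarith

/-- On ‖z‖² ≤ R, with R just above the quantile at α, the error is at most √R plus a vanishing bias
√t (1 - m), while the radius is at least some q just below the quantile at β. The strict condition
on L leaves a gap for the bias, and α < β leaves one for the posterior mass of shrinking scales. -/
lemma coverage_large_means (hk : 0 < k) (hS : S.PosDef) (h : IsLocalPrior a K ℓ)
    {KL α β ρ L : ℝ} (hKL : 2 * a < KL) (hα : 0 < α) (hαβ : α < β) (hβ : β < 1) (hρ : 0 < ρ)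
    (hL0 : 0 < L) (hL : chiSqUpper k α < L * chiSqUpper k β ^ (a / (1 + ρ))) :
    ∀ᶠ τ in 𝓝[>] 0, ∀ θ₀ ∈ largeMeans S KL τ, 1 - α ≤ coverProb S a K ℓ α ρ L τ θ₀ := by
  have ha := h.a_pos
  set e := a / (1 + ρ) with he
  have he0 : 0 < e := by positivity
  have hχ : 0 < chiSqUpper k β := chiSqUpper_pos hk (by linarith) hβ
  obtain ⟨q, ⟨hq0, hqβ⟩, hq⟩ : ∃ q, (0 < q ∧ q < chiSqUpper k β) ∧ chiSqUpper k α < L * q ^ e := by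
    have hcont : Tendsto (fun q : ℝ => L * q ^ e) (𝓝[<] chiSqUpper k β)
        (𝓝 (L * chiSqUpper k β ^ e)) :=
      ((Real.continuousAt_rpow_const _ e (Or.inr he0.le)).const_mul L).tendsto.mono_left
        nhdsWithin_le_nhds
    have hmem : ∀ᶠ q : ℝ in 𝓝[<] chiSqUpper k β, 0 < q ∧ q < chiSqUpper k β := Ioo_mem_nhdsLT hχ
    exact (hmem.and (hcont.eventually_const_lt hL)).exists
  obtain ⟨q', hqq', hq'β⟩ := exists_between hqβ
  obtain ⟨R, hαR, hRL⟩ := exists_between hq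
  have hR0 : 0 ≤ R := (chiSqUpper_nonneg α).trans hαR.le
  have hF := normSqCdf_lt_of_lt_chiSqUpper (hq0.trans hqq').le hq'β
  have hcov := le_normSqCdf_of_chiSqUpper_lt hα hαR
  have hη : 0 < √(L * q ^ e) - √R := sub_pos.2 (Real.sqrt_lt_sqrt hR0 hRL)
  have hqq1 : q / q' < 1 := (div_lt_one (hq0.trans hqq')).2 hqq'
  have hqq0 : 0 < q / q' := div_pos hq0 (hq0.trans hqq')
  -- The three slacks serve, in order, the bias, the division of q by 1 - ε, and the mass of scales
  -- with s < 1 - ε.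
  obtain ⟨ε, hε0, hε⟩ : ∃ ε, 0 < ε ∧ ε ≤ min (√(L * q ^ e) - √R) (min (1 - q / q') (β - α)) :=
    ⟨_, lt_min hη (lt_min (by linarith) (by linarith)), le_rfl⟩
  have hε1 : ε ≤ √(L * q ^ e) - √R := hε.trans (min_le_left _ _)
  have hε2 : ε ≤ 1 - q / q' := hε.trans ((min_le_right _ _).trans (min_le_left _ _))
  have hε3 : ε ≤ β - α := hε.trans ((min_le_right _ _).trans (min_le_right _ _))
  set K' := (2 * a + KL) / 2 with hK'
  have hK'a : 2 * a < K' := by rw [hK']; linarith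
  have hK'0 : 0 < K' := by linarith
  have hK'L : K' < KL := by rw [hK']; linarith
  obtain ⟨T, hT⟩ := exists_no_shrinkage k h hK'a hε0
  set w := (KL - K') / (2 * K') with hw
  have hw0 : 0 < w := by rw [hw]; apply div_pos <;> linarith
  have hwK : (1 + w) * K' < KL := by
    have : (1 + w) * K' = (KL + K') / 2 := by rw [hw]; field_simp; ring
    linarith
  filter_upwards [eventually_pos_lt_one,
    tendsto_log_one_div.eventually_ge_atTop ((1 + 1 / w) * R / (KL - (1 + w) * K')),
    tendsto_log_one_div.eventually_ge_atTop (T / K')] with τ ⟨hτ, hτ1⟩ h3 h4 θ₀ hθ₀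
  set Λ := Real.log (1 / τ) with hΛdef
  refine hcov.trans (normSqCdf_le_real θ₀ _ fun z hz => ?_)
  set x := θ₀ + sqrtCLM S z with hx
  have hy : whiten S x = whiten S θ₀ + z := whiten_add hS θ₀ z
  have hθ : KL * Λ ≤ ‖whiten S θ₀‖ ^ 2 := by rw [← mahalSq_eq hS]; exact hθ₀
  set t := ‖whiten S x‖ ^ 2 with ht
  have htK : K' * Λ ≤ t := by
    have h5 := norm_add_sq_le_weighted (whiten S x) (-z) hw0
    rw [norm_neg, ← sub_eq_add_neg, hy, add_sub_cancel_right, ← hy] at h5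
    rw [div_le_iff₀ (by linarith)] at h3
    have h7 : (1 + 1 / w) * ‖z‖ ^ 2 ≤ (1 + 1 / w) * R := by gcongr
    have h8 : (1 + w) * (K' * Λ) ≤ (1 + w) * t := by linarith
    exact le_of_mul_le_mul_left h8 (by linarith)
  have hTt : T ≤ t := by
    rw [div_le_iff₀ hK'0] at h4
    linarith
  obtain ⟨hm, hpost⟩ := hT τ t hτ hτ1 hTt htK
  have hr : q ≤ credRadius S a K ℓ α τ x := by
    refine le_credRadius hS h hτ x hα (s₁ := 1 - ε) (by linarith) ?_
    have h5 : q / (1 - ε) ≤ q' := by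
      rw [div_le_iff₀ (by linarith), mul_comm, ← div_le_iff₀ (hq0.trans hqq')]
      linarith
    have h6 := normSqCdf_mono (k := k) h5
    linarith
  have hm1 : shrinkMean k a K ℓ τ t ≤ 1 := shrinkMean_le_one h hτ (by positivity)
  change mahalSq S (θ₀ - posteriorMean S a K ℓ τ x) ≤ L * credRadius S a K ℓ α τ x ^ e
  rw [mahalSq_sub_posteriorMean hS h hτ]
  have h5 : ‖whiten S θ₀ - shrinkMean k a K ℓ τ t • whiten S x‖ ≤ √(L * q ^ e) := by
    have e1 : whiten S θ₀ - shrinkMean k a K ℓ τ t • whiten S x =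
        -z + (1 - shrinkMean k a K ℓ τ t) • whiten S x := by
      rw [sub_smul, one_smul]; nth_rewrite 2 [hy]; abel
    have h6 : ‖z‖ ≤ √R := Real.le_sqrt_of_sq_le hz
    have h7 : √t = ‖whiten S x‖ := Real.sqrt_sq (norm_nonneg _)
    rw [e1]
    refine (norm_add_le _ _).trans ?_
    rw [norm_neg, norm_smul, Real.norm_eq_abs, abs_of_nonneg (by linarith), ← h7, mul_comm]
    linarith
  calc _ ≤ √(L * q ^ e) ^ 2 := pow_le_pow_left₀ (norm_nonneg _) h5 2
    _ = L * q ^ e := Real.sq_sqrt (by positivity)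
    _ ≤ _ := by gcongr

end GlobalLocal

end

theorem theorem6 :
    ∃ f : ℝ → ℝ,
      Tendsto f (𝓝[>] 0) atTop ∧ Tendsto (fun t => f t * t) (𝓝[>] 0) (𝓝 0) ∧
      ∀ (k : ℕ), 0 < k →
      ∀ (S : Matrix (Fin k) (Fin k) ℝ), S.PosDef →
      ∀ (a K : ℝ) (ℓ : ℝ → ℝ), GlobalLocal.IsLocalPrior a K ℓ → a < 1 →
      ∀ (KS KM KL : ℝ), 0 < KS → 0 < KM → KM < 2 * a → 2 * a < KL →
      ∀ (α β ρ L : ℝ), 0 < α → α < β → β < 1 → 0 < ρ →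
        GlobalLocal.chiSqUpper k α * GlobalLocal.chiSqUpper k β ^ (-(a / (1 + ρ))) < L →
      ∀ (τ : ℕ → ℝ), (∀ n, 0 < τ n ∧ τ n < 1) → Tendsto τ atTop (𝓝 0) →
        (∀ᶠ n in atTop, ∀ θ₀ ∈ GlobalLocal.smallMeans S KS (τ n),
          1 - α ≤ GlobalLocal.coverProb S a K ℓ α ρ L (τ n) θ₀) ∧
        (∀ ε : ℝ, 0 < ε → ∀ᶠ n in atTop, ∀ θ₀ ∈ GlobalLocal.mediumMeans S f KM (τ n),
          1 - ε ≤ GlobalLocal.missProb S a K ℓ α ρ L (τ n) θ₀) ∧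
        (∀ᶠ n in atTop, ∀ θ₀ ∈ GlobalLocal.largeMeans S KL (τ n),
          1 - α ≤ GlobalLocal.coverProb S a K ℓ α ρ L (τ n) θ₀) := by
  -- Then f_τ τ = 1/log(1/τ) tends to zero more slowly than any positive power of τ, so one f serves
  -- for all parameters.
  refine ⟨fun t => 1 / (t * Real.log (1 / t)), ?_, ?_, ?_⟩
  · have h1 : Tendsto (fun t : ℝ => t * Real.log (1 / t)) (𝓝[>] 0) (𝓝[>] 0) := by
      refine tendsto_nhdsWithin_iff.2 ⟨?_, ?_⟩
      · simpa using GlobalLocal.tendsto_rpow_mul_log_one_div one_pos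
      · filter_upwards [GlobalLocal.eventually_pos_lt_one] with t ⟨ht, ht1⟩
        exact mul_pos ht (Real.log_pos ((one_lt_div ht).2 ht1))
    simp_rw [one_div] at h1 ⊢
    exact tendsto_inv_nhdsGT_zero.comp h1
  · refine (tendsto_inv_atTop_zero.comp GlobalLocal.tendsto_log_one_div).congr' ?_
    filter_upwards [self_mem_nhdsWithin] with t ht
    have ht : t ≠ 0 := ne_of_gt ht
    rw [Function.comp_apply, one_div (t * _), mul_inv, mul_right_comm, inv_mul_cancel₀ ht, one_mul]
  · intro k hk S hS a K ℓ h ha1 KS KM KL hKS hKM hKMa hKL α β ρ L hα hαβ hβ hρ hL τ hτ hτ0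
    have hχ : 0 < GlobalLocal.chiSqUpper k β := GlobalLocal.chiSqUpper_pos hk (by linarith) hβ
    have hχα : 0 ≤ GlobalLocal.chiSqUpper k α := GlobalLocal.chiSqUpper_nonneg α
    have hL0 : 0 < L := lt_of_le_of_lt (by positivity) hL
    have hL' : GlobalLocal.chiSqUpper k α < L * GlobalLocal.chiSqUpper k β ^ (a / (1 + ρ)) := by
      rwa [Real.rpow_neg hχ.le, ← div_eq_mul_inv, div_lt_iff₀ (by positivity)] at hL
    have hlim : Tendsto τ atTop (𝓝[>] 0) :=
      tendsto_nhdsWithin_iff.2 ⟨hτ0, Eventually.of_forall fun n => (hτ n).1⟩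
    refine ⟨hlim.eventually (GlobalLocal.coverage_small_means hk hS h ha1 hKS hα
      (hαβ.trans hβ) hρ hL0), fun ε hε => ?_,
      hlim.eventually (GlobalLocal.coverage_large_means hk hS h hKL hα hαβ hβ hρ hL0 hL')⟩
    filter_upwards [hlim.eventually (GlobalLocal.miss_medium_means hS h ha1 hKM hKMa hα hρ hL0 hε)]
      with n hn θ₀ hθ₀
    refine hn θ₀ (le_trans (le_of_eq ?_) hθ₀.1) hθ₀.2
    have hτn : τ n ≠ 0 := (hτ n).1.ne'
    beta_reduce
    rw [one_div (τ n * _), mul_inv, mul_right_comm, inv_mul_cancel₀ hτn, one_mul, one_div]
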